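/- Let three parties $A_1,A_2,A_3$ each have two measurement settings $x_i\in\{0,1\}$ and two outcomes $a_i\in\{0,1\}$, and write $p(a_1a_2a_3|x_1x_2x_3)$ for their correlations. Consider the Bell inequality $$p(000|000)-p(100|100)-p(010|010)-p(001|001)-p(000|110)-p(000|101)\le 0 .\qquad (*)$$ Call a correlation local across a bipartition $S|\bar S$ of the parties into two nonempty sets if $p(\mathbf a|\mathbf x)=\sum_\lambda q_\lambda\, p_S(\mathbf a_S|\mathbf x_S,\lambda)\,p_{\bar S}(\mathbf a_{\bar S}|\mathbf x_{\bar S},\lambda)$ with a probability distribution $(q_\lambda)$ and non-signaling conditional probability distributions $p_S(\cdot|\cdot,\lambda)$, $p_{\bar S}(\cdot|\cdot,\lambda)$; call it bilocal if it is a convex combination, over the bipartitions $S|\bar S$, of correlations local across $S|\bar S$; and call it genuinely multipartite nonlocal if it is not bilocal. A unit vector $|\psi\rangle\in(\mathbb C^2)^{\otimes 3}$ is genuinely multipartite entangled if, for every bipartition $S|\bar S$ into two nonempty sets, it is not of the form $|\phi_S\rangle\otimes|\phi_{\bar S}\rangle$. Theorem. Inequality $(*)$ holds for all bilocal correlations.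 Every pure three-qubit state $|\psi\rangle\in(\mathbb C^2)^{\otimes 3}$ that is genuinely multipartite entangled violates $(*)$: for each of the three parties there are two projective measurements, each in an orthonormal basis of $\mathbb C^2$, such that the resulting correlations $p(a_1a_2a_3|x_1x_2x_3)=\big|\big(\langle M^{(1)}_{a_1|x_1}|\otimes\langle M^{(2)}_{a_2|x_2}|\otimes\langle M^{(3)}_{a_3|x_3}|\big)|\psi\rangle\big|^2$ make the left-hand side of $(*)$ strictly positive, where $|M^{(i)}_{a|x}\rangle$ is the basis vector of party $A_i$ for setting $x$ and outcome $a$. Consequently these correlations are genuinely multipartite nonlocal, so the single Bell inequality $(*)$ detects genuine nonlocality in every pure genuinely multipartite entangled three-qubit state. -/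

import Mathlib

namespace BellScenario

noncomputable section

/-! ### Pure states of qubits and genuine multipartite entanglement -/

/-- The state space of one qubit, the Hilbert space `ℂ²`. -/
abbrev Qubit : Type := EuclideanSpace ℂ (Fin 2)

/-- The state space of a family of qubits indexed by the parties `ι`, i.e. the tensor product of
copies of `ℂ²`, written in the computational product basis: a vector is a family of
amplitudes indexed by the bit strings `ι → Fin 2`. -/
abbrev QubitSpace (ι : Type) : Type := EuclideanSpace ℂ (ι → Fin 2)

/-- `ψ` is a product vector across `S | Sᶜ`: it equals `φ ⊗ χ` with `φ` a vector of the qubits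
in `S` and `χ` a vector of the remaining qubits. -/
def IsProductAcross {ι : Type} [Fintype ι] [DecidableEq ι] (S : Finset ι)
    (ψ : QubitSpace ι) : Prop :=
  ∃ (φ : QubitSpace {i // i ∈ S}) (χ : QubitSpace {i // i ∈ Sᶜ}),
    ∀ s : ι → Fin 2, ψ s = φ (fun i => s i) * χ (fun i => s i)

/-- The pure state `ψ` is genuinely multipartite entangled: it is entangled across every
bipartition of the parties into two nonempty sets. -/
def IsGME {ι : Type} [Fintype ι] [DecidableEq ι] (ψ : QubitSpace ι) : Prop :=
  ∀ S : Finset ι, S.Nonempty → Sᶜ.Nonempty → ¬ IsProductAcross S ψ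

/-! ### Correlations -/

/-- Behaviours `p(a|x)` for the parties `ι`, each with two measurement settings and two outcomes;
`p a x` is the number `p(a|x)`. -/
abbrev Correlation (ι : Type) : Type := (ι → Fin 2) → (ι → Fin 2) → ℝ

/-- `p(·|x)` is a probability distribution for all settings `x`, and `p` obeys the non-signaling
principle: the marginal on any set `T` of parties depends on the settings of `T` only. -/
structure IsNonsignaling {ι : Type} [Fintype ι] [DecidableEq ι] (p : Correlation ι) : Prop where
  nonneg : ∀ a x, 0 ≤ p a x
  sum_eq_one : ∀ x, ∑ a, p a x = 1
  marginal : ∀ (T : Finset ι) (x y : ι → Fin 2), (∀ i ∈ T, x i = y i) → ∀ b : ι → Fin 2,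
    ∑ a with (∀ i ∈ T, a i = b i), p a x = ∑ a with (∀ i ∈ T, a i = b i), p a y

/-- `p` is local across `S | Sᶜ`: there is a hidden variable `l` with distribution `q`, and for
every value of it non-signaling distributions `pS`, `pT` of the parties in `S` and in `Sᶜ`, such
that `p(a|x) = ∑ l, q l * pS(a_S|x_S,l) * pT(a_Sᶜ|x_Sᶜ,l)`. -/
def IsLocalAcross {ι : Type} [Fintype ι] [DecidableEq ι] (S : Finset ι)
    (p : Correlation ι) : Prop :=
  ∃ (k : ℕ) (q : Fin k → ℝ) (pS : Fin k → Correlation {i // i ∈ S})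
    (pT : Fin k → Correlation {i // i ∈ Sᶜ}),
    (∀ l, 0 ≤ q l) ∧ ∑ l, q l = 1 ∧
    (∀ l, IsNonsignaling (pS l)) ∧ (∀ l, IsNonsignaling (pT l)) ∧
    ∀ a x : ι → Fin 2, p a x =
      ∑ l, q l * pS l (fun i => a i) (fun i => x i) * pT l (fun i => a i) (fun i => x i)

/-- The sets `S` for which `S | Sᶜ` is a bipartition into two nonempty sets. -/
def bipartitions (ι : Type) [Fintype ι] [DecidableEq ι] : Finset (Finset ι) :=
  {S | S.Nonempty ∧ Sᶜ.Nonempty}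

/-- `p` is bilocal: a convex combination, over the bipartitions `S | Sᶜ`, of correlations that are
local across `S | Sᶜ`. (Listing a bipartition both as `S` and as `Sᶜ` changes nothing, as weights
may vanish and being local across `S | Sᶜ` is symmetric.) -/
def IsBilocal {ι : Type} [Fintype ι] [DecidableEq ι] (p : Correlation ι) : Prop :=
  ∃ (r : Finset ι → ℝ) (P : Finset ι → Correlation ι),
    (∀ S ∈ bipartitions ι, 0 ≤ r S) ∧ ∑ S ∈ bipartitions ι, r S = 1 ∧
    (∀ S ∈ bipartitions ι, IsLocalAcross S (P S)) ∧
    ∀ a x : ι → Fin 2, p a x = ∑ S ∈ bipartitions ι, r S * P S a x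

/-- `p` is genuinely multipartite nonlocal: it is not bilocal. -/
def IsGMNL {ι : Type} [Fintype ι] [DecidableEq ι] (p : Correlation ι) : Prop :=
  ¬ IsBilocal p

/-- The Bell expression
`p(000|000) - p(100|100) - p(010|010) - p(001|001) - p(000|110) - p(000|101)`. -/
def improvedBell (p : Correlation (Fin 3)) : ℝ :=
  p ![0, 0, 0] ![0, 0, 0] - p ![1, 0, 0] ![1, 0, 0] - p ![0, 1, 0] ![0, 1, 0]
    - p ![0, 0, 1] ![0, 0, 1] - p ![0, 0, 0] ![1, 1, 0] - p ![0, 0, 0] ![1, 0, 1]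

/-! ### Correlations produced by local projective measurements -/

/-- The product vector `⨂ i, v i`. -/
def productVector {ι : Type} [Fintype ι] (v : ι → Qubit) : QubitSpace ι :=
  WithLp.toLp 2 fun s => ∏ i, v i (s i)

/-- Local projective qubit measurements with two settings: for setting `x`, party `i` measures in
the orthonormal basis `M i x`, whose vector `M i x a` belongs to the outcome `a`. -/
abbrev Measurements (ι : Type) : Type := ι → Fin 2 → OrthonormalBasis (Fin 2) ℂ Qubit

/-- The correlation that the measurements `M` produce on the pure state `ψ` (Born rule):
`p(a|x) = |⟨⨂ i, M i (x i) (a i), ψ⟩|²`. -/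
def bornCorrelation {ι : Type} [Fintype ι] [DecidableEq ι] (ψ : QubitSpace ι) (M : Measurements ι) :
    Correlation ι :=
  fun a x => ‖inner ℂ (productVector fun i => M i (x i) (a i)) ψ‖ ^ 2

end

end BellScenario

open BellScenario

/-!
A product across a cut `{i} | rest` satisfies the inequality because, with `α`, `β` the
probabilities that the isolated party outputs `0`, the nonvanishing part of the Bell expression is
at most `(α + β - 1) g - α u - β w`, where `g ≤ u + w` by the no-signaling principle (`cut_bound`).
Linearity extends this to bilocal correlations.

For the violation, the amplitudes of a state form a tensor `t i j k`, and a choice of measurements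
is a choice of vectors `a i`, `b i` (one per party and setting, standing for the outcome `0`);
the Bell expression becomes `bellValue t a b`. Since every two-dimensional subspace of `ℂ² ⊗ ℂ²`
contains a product vector, local bases can be chosen in which the amplitudes `t · 0 0` vanish
(`exists_common_zero`), and moreover `t 1 1 0 = 0`. With `v = t · 1 0` and `w = t · 0 1`, both
nonzero by entanglement, three cases remain.

* `v` and `w` are neither parallel nor orthogonal (`violates_of_generic`). There are measurements
  at which all six amplitudes vanish, and a curve through them along which only the amplitude of
  the positive term is nonzero to first order.
* `v ⟂ w` (`violates_of_orthogonal`), which includes the GHZ state. Phases make `t` real, and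
  Hardy-type measurements exist, for which all negative terms vanish and the positive one does not.
  The Hardy conditions reduce to one real polynomial equation, solved by the intermediate value
  theorem (`exists_hardy_orthogonal`).
* `v ∥ w` (`violates_of_parallel`), which includes the W state. Again `t` becomes real and the
  Hardy conditions reduce to a cubic equation (`exists_hardy_parallel`).
-/

namespace BellScenario

/-! ### Bilocal correlations satisfy the inequality -/

/-- The nonsignaling bound used for every cut: summing over the outcome of party `i` gives a
quantity that does not depend on the setting of party `i`. -/
theorem IsNonsignaling.update_add_update {ι : Type} [Fintype ι] [DecidableEq ι]
    {p : Correlation ι} (hp : IsNonsignaling p) (i : ι) (a x y : ι → Fin 2)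
    (hxy : ∀ j, j ≠ i → x j = y j) :
    p (Function.update a i 0) x + p (Function.update a i 1) x =
      p (Function.update a i 0) y + p (Function.update a i 1) y := by
  have hne : Function.update a i 0 ≠ Function.update a i 1 := fun h => by
    simpa using congrFun h i
  have hset : (Finset.univ.filter fun b : ι → Fin 2 => ∀ j ∈ ({i}ᶜ : Finset ι), b j = a j) =
      {Function.update a i 0, Function.update a i 1} := by
    ext b
    simp only [Finset.mem_filter, Finset.mem_univ, true_and, Finset.mem_compl,
      Finset.mem_singleton, Finset.mem_insert, Function.eq_update_iff]
    constructor
    · intro h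
      rcases Fin.exists_fin_two.1 ⟨b i, rfl⟩ with h0 | h0
      · exact Or.inl ⟨h0, h⟩
      · exact Or.inr ⟨h0, h⟩
    · rintro (⟨-, h⟩ | ⟨-, h⟩) <;> exact h
  have h := hp.marginal {i}ᶜ x y (fun j hj => hxy j (by simpa using hj)) a
  rwa [hset, Finset.sum_pair hne, Finset.sum_pair hne] at h

/-- The distribution of a single party is normalized over its two outcomes. -/
theorem IsNonsignaling.update_add_update_eq_one {ι : Type} [Fintype ι] [DecidableEq ι]
    {p : Correlation ι} (hp : IsNonsignaling p) (i : ι) (hi : ∀ j, j = i) (a x : ι → Fin 2) :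
    p (Function.update a i 0) x + p (Function.update a i 1) x = 1 := by
  have hne : Function.update a i 0 ≠ Function.update a i 1 := fun h => by
    simpa using congrFun h i
  rw [← hp.sum_eq_one x, ← Finset.sum_pair (f := fun b => p b x) hne]
  refine Finset.sum_subset (Finset.subset_univ _) fun b _ hb => absurd ?_ hb
  simp only [Finset.mem_insert, Finset.mem_singleton, Function.eq_update_iff]
  rcases Fin.exists_fin_two.1 ⟨b i, rfl⟩ with h0 | h0
  · exact Or.inl ⟨h0, fun j hj => absurd (hi j) hj⟩
  · exact Or.inr ⟨h0, fun j hj => absurd (hi j) hj⟩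

/-- The elementary inequality behind the local bound: `α` and `β` are the probabilities of the
outcome `0` of the isolated party for its two settings. -/
theorem cut_bound {α β g u w : ℝ} (hα : 0 ≤ α) (hα1 : α ≤ 1) (hβ : 0 ≤ β) (hβ1 : β ≤ 1)
    (hg : 0 ≤ g) (hu : 0 ≤ u) (hw : 0 ≤ w) (h : g ≤ u + w) :
    (α + β - 1) * g ≤ α * u + β * w := by
  rcases le_total (α + β) 1 with h1 | h1
  · have : (α + β - 1) * g ≤ 0 := mul_nonpos_of_nonpos_of_nonneg (by linarith) hg
    have := mul_nonneg hα hu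
    have := mul_nonneg hβ hw
    linarith
  · have := mul_le_mul_of_nonneg_left h (by linarith : 0 ≤ α + β - 1)
    have := mul_nonneg (by linarith : 0 ≤ 1 - β) hu
    have := mul_nonneg (by linarith : 0 ≤ 1 - α) hw
    nlinarith

/-- The Bell expression is nonpositive on a product of a distribution `F` of party `i` and a
nonsignaling distribution `G` of the other two parties, both read as functions of all outcomes
and settings. -/
theorem improvedBell_mul_nonpos (i : Fin 3) (F G : Correlation (Fin 3))
    (hF : ∀ a x, 0 ≤ F a x)
    (hFi : ∀ a b x y, a i = b i → x i = y i → F a x = F b y)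
    (hF1 : ∀ a x, F (Function.update a i 0) x + F (Function.update a i 1) x = 1)
    (hG : ∀ a x, 0 ≤ G a x)
    (hGi : ∀ a b x y, (∀ j, j ≠ i → a j = b j) → (∀ j, j ≠ i → x j = y j) → G a x = G b y)
    (hGns : ∀ j, j ≠ i → ∀ a x y, (∀ k, k ≠ j → x k = y k) →
      G (Function.update a j 0) x + G (Function.update a j 1) x =
        G (Function.update a j 0) y + G (Function.update a j 1) y) :
    improvedBell (fun a x => F a x * G a x) ≤ 0 := by
  have hle : ∀ a x, F a x ≤ 1 := fun a x => by
    rcases Fin.exists_fin_two.1 ⟨a i, rfl⟩ with h0 | h0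
    · rw [hFi a (Function.update a i 0) x x (by simp [h0]) rfl]
      linarith [hF1 a x, hF (Function.update a i 1) x]
    · rw [hFi a (Function.update a i 1) x x (by simp [h0]) rfl]
      linarith [hF1 a x, hF (Function.update a i 0) x]
  unfold improvedBell
  dsimp only
  fin_cases i
  · have e1 := hF1 ![0, 0, 0] ![1, 0, 0]
    have e2 := hGns 1 (by decide) ![0, 0, 0] ![0, 0, 0] ![0, 1, 0] (by decide)
    have u0 : Function.update (![0, 0, 0] : Fin 3 → Fin 2) 0 0 = ![0, 0, 0] := by decide
    have u1 : Function.update (![0, 0, 0] : Fin 3 → Fin 2) 0 1 = ![1, 0, 0] := by decide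
    have u2 : Function.update (![0, 0, 0] : Fin 3 → Fin 2) 1 0 = ![0, 0, 0] := by decide
    have u3 : Function.update (![0, 0, 0] : Fin 3 → Fin 2) 1 1 = ![0, 1, 0] := by decide
    simp only [Fin.zero_eta, u0, u1, u2, u3] at e1 e2
    have f1 : F ![0, 1, 0] ![0, 1, 0] = F ![0, 0, 0] ![0, 0, 0] :=
      hFi _ _ _ _ (by decide) (by decide)
    have f2 : F ![0, 0, 0] ![1, 1, 0] = F ![0, 0, 0] ![1, 0, 0] :=
      hFi _ _ _ _ (by decide) (by decide)
    have g1 : G ![1, 0, 0] ![1, 0, 0] = G ![0, 0, 0] ![0, 0, 0] :=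
      hGi _ _ _ _ (by decide) (by decide)
    have g2 : G ![0, 0, 0] ![1, 1, 0] = G ![0, 0, 0] ![0, 1, 0] :=
      hGi _ _ _ _ (by decide) (by decide)
    have key := cut_bound (hF ![0, 0, 0] ![0, 0, 0]) (hle _ _) (hF ![0, 0, 0] ![1, 0, 0]) (hle _ _)
      (hG ![0, 0, 0] ![0, 0, 0]) (hG ![0, 1, 0] ![0, 1, 0]) (hG ![0, 0, 0] ![0, 1, 0])
      (by linarith [hG ![0, 1, 0] ![0, 0, 0]])
    rw [f1, f2, g1, g2, show F ![1, 0, 0] ![1, 0, 0] = 1 - F ![0, 0, 0] ![1, 0, 0] by linarith]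
    have := mul_nonneg (hF ![0, 0, 1] ![0, 0, 1]) (hG ![0, 0, 1] ![0, 0, 1])
    have := mul_nonneg (hF ![0, 0, 0] ![1, 0, 1]) (hG ![0, 0, 0] ![1, 0, 1])
    nlinarith
  · have e1 := hF1 ![0, 0, 0] ![0, 1, 0]
    have e2 := hGns 0 (by decide) ![0, 0, 0] ![0, 0, 0] ![1, 0, 0] (by decide)
    have u0 : Function.update (![0, 0, 0] : Fin 3 → Fin 2) 0 0 = ![0, 0, 0] := by decide
    have u1 : Function.update (![0, 0, 0] : Fin 3 → Fin 2) 0 1 = ![1, 0, 0] := by decide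
    have u2 : Function.update (![0, 0, 0] : Fin 3 → Fin 2) 1 0 = ![0, 0, 0] := by decide
    have u3 : Function.update (![0, 0, 0] : Fin 3 → Fin 2) 1 1 = ![0, 1, 0] := by decide
    simp only [Fin.mk_one, u0, u1, u2, u3] at e1 e2
    have f1 : F ![1, 0, 0] ![1, 0, 0] = F ![0, 0, 0] ![0, 0, 0] :=
      hFi _ _ _ _ (by decide) (by decide)
    have f2 : F ![0, 0, 0] ![1, 1, 0] = F ![0, 0, 0] ![0, 1, 0] :=
      hFi _ _ _ _ (by decide) (by decide)
    have g1 : G ![0, 1, 0] ![0, 1, 0] = G ![0, 0, 0] ![0, 0, 0] :=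
      hGi _ _ _ _ (by decide) (by decide)
    have g2 : G ![0, 0, 0] ![1, 1, 0] = G ![0, 0, 0] ![1, 0, 0] :=
      hGi _ _ _ _ (by decide) (by decide)
    have key := cut_bound (hF ![0, 0, 0] ![0, 0, 0]) (hle _ _) (hF ![0, 0, 0] ![0, 1, 0]) (hle _ _)
      (hG ![0, 0, 0] ![0, 0, 0]) (hG ![1, 0, 0] ![1, 0, 0]) (hG ![0, 0, 0] ![1, 0, 0])
      (by linarith [hG ![1, 0, 0] ![0, 0, 0]])
    rw [f1, f2, g1, g2, show F ![0, 1, 0] ![0, 1, 0] = 1 - F ![0, 0, 0] ![0, 1, 0] by linarith]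
    have := mul_nonneg (hF ![0, 0, 1] ![0, 0, 1]) (hG ![0, 0, 1] ![0, 0, 1])
    have := mul_nonneg (hF ![0, 0, 0] ![1, 0, 1]) (hG ![0, 0, 0] ![1, 0, 1])
    nlinarith
  · have e1 := hF1 ![0, 0, 0] ![0, 0, 1]
    have e2 := hGns 0 (by decide) ![0, 0, 0] ![0, 0, 0] ![1, 0, 0] (by decide)
    have u0 : Function.update (![0, 0, 0] : Fin 3 → Fin 2) 0 0 = ![0, 0, 0] := by decide
    have u1 : Function.update (![0, 0, 0] : Fin 3 → Fin 2) 0 1 = ![1, 0, 0] := by decide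
    have u2 : Function.update (![0, 0, 0] : Fin 3 → Fin 2) 2 0 = ![0, 0, 0] := by decide
    have u3 : Function.update (![0, 0, 0] : Fin 3 → Fin 2) 2 1 = ![0, 0, 1] := by decide
    simp only [Fin.reduceFinMk, u0, u1, u2, u3] at e1 e2
    have f1 : F ![1, 0, 0] ![1, 0, 0] = F ![0, 0, 0] ![0, 0, 0] :=
      hFi _ _ _ _ (by decide) (by decide)
    have f2 : F ![0, 0, 0] ![1, 0, 1] = F ![0, 0, 0] ![0, 0, 1] :=
      hFi _ _ _ _ (by decide) (by decide)
    have g1 : G ![0, 0, 1] ![0, 0, 1] = G ![0, 0, 0] ![0, 0, 0] :=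
      hGi _ _ _ _ (by decide) (by decide)
    have g2 : G ![0, 0, 0] ![1, 0, 1] = G ![0, 0, 0] ![1, 0, 0] :=
      hGi _ _ _ _ (by decide) (by decide)
    have key := cut_bound (hF ![0, 0, 0] ![0, 0, 0]) (hle _ _) (hF ![0, 0, 0] ![0, 0, 1]) (hle _ _)
      (hG ![0, 0, 0] ![0, 0, 0]) (hG ![1, 0, 0] ![1, 0, 0]) (hG ![0, 0, 0] ![1, 0, 0])
      (by linarith [hG ![1, 0, 0] ![0, 0, 0]])
    rw [f1, f2, g1, g2, show F ![0, 0, 1] ![0, 0, 1] = 1 - F ![0, 0, 0] ![0, 0, 1] by linarith]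
    have := mul_nonneg (hF ![0, 1, 0] ![0, 1, 0]) (hG ![0, 1, 0] ![0, 1, 0])
    have := mul_nonneg (hF ![0, 0, 0] ![1, 1, 0]) (hG ![0, 0, 0] ![1, 1, 0])
    nlinarith

/-- Read as a function of all outcomes and settings, a nonsignaling distribution of the parties in
`T` obeys the no-signaling identity of every party of `T`. -/
theorem restrict_update_add_update {ι : Type} [Fintype ι] [DecidableEq ι] {T : Finset ι}
    {p : Correlation {i // i ∈ T}} (hp : IsNonsignaling p) {j : ι} (hj : j ∈ T)
    (a x y : ι → Fin 2) (hxy : ∀ k, k ≠ j → x k = y k) :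
    p (fun i => Function.update a j 0 i) (fun i => x i) +
        p (fun i => Function.update a j 1 i) (fun i => x i) =
      p (fun i => Function.update a j 0 i) (fun i => y i) +
        p (fun i => Function.update a j 1 i) (fun i => y i) := by
  have hr : ∀ v, (fun i : {i // i ∈ T} => Function.update a j v i) =
      Function.update (fun i : {i // i ∈ T} => a i) ⟨j, hj⟩ v := fun v => by
    ext i
    by_cases h : i = ⟨j, hj⟩
    · subst h; simp
    · have h' : (i : ι) ≠ j := fun e => h (Subtype.ext e)
      simp [Function.update_of_ne h, Function.update_of_ne h']
  rw [hr, hr]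
  exact hp.update_add_update ⟨j, hj⟩ _ _ _ fun k hk => hxy k fun e => hk (Subtype.ext e)

/-- A product across `S | T` of nonsignaling distributions satisfies the inequality, when `S`
consists of one party and `T` of the two others. -/
theorem improvedBell_prod_nonpos {i : Fin 3} {S T : Finset (Fin 3)} (hS : ∀ j, j ∈ S ↔ j = i)
    (hT : ∀ j, j ∈ T ↔ j ≠ i) {pS : Correlation {i // i ∈ S}} {pT : Correlation {i // i ∈ T}}
    (h1 : IsNonsignaling pS) (h2 : IsNonsignaling pT) :
    improvedBell (fun a x => pS (fun i => a i) (fun i => x i) * pT (fun i => a i) (fun i => x i))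
      ≤ 0 := by
  refine improvedBell_mul_nonpos i (fun a x => pS (fun i => a i) (fun i => x i))
    (fun a x => pT (fun i => a i) (fun i => x i)) (fun a x => h1.nonneg _ _) ?_ ?_
    (fun a x => h2.nonneg _ _) ?_ ?_
  · intro a b x y ha hx
    have e : ∀ {f g : Fin 3 → Fin 2}, f i = g i →
        (fun j : {j // j ∈ S} => f j) = fun j : {j // j ∈ S} => g j := fun h => by
      ext j; rw [(hS j).1 j.2, h]
    simp only [e ha, e hx]
  · intro a x
    have hi : i ∈ S := (hS i).2 rfl
    have hr : ∀ v, (fun j : {j // j ∈ S} => Function.update a i v j) =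
        Function.update (fun j : {j // j ∈ S} => a j) ⟨i, hi⟩ v := fun v => by
      ext j
      have h : j = ⟨i, hi⟩ := Subtype.ext ((hS j).1 j.2)
      subst h; simp
    simp only [hr]
    exact h1.update_add_update_eq_one ⟨i, hi⟩ (fun j => Subtype.ext ((hS j).1 j.2)) _ _
  · intro a b x y ha hx
    have e : ∀ {f g : Fin 3 → Fin 2}, (∀ j, j ≠ i → f j = g j) →
        (fun j : {j // j ∈ T} => f j) = fun j : {j // j ∈ T} => g j := fun h => by
      ext j; rw [h j ((hT j).1 j.2)]
    simp only [e ha, e hx]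
  · intro j hj a x y hxy
    exact restrict_update_add_update h2 ((hT j).2 hj) a x y hxy

/-- The Bell expression is linear in the correlation. -/
theorem improvedBell_sum {α : Type} (s : Finset α) (r : α → ℝ) (P : α → Correlation (Fin 3)) :
    improvedBell (fun a x => ∑ l ∈ s, r l * P l a x) = ∑ l ∈ s, r l * improvedBell (P l) := by
  simp only [improvedBell, mul_sub, Finset.sum_sub_distrib]

theorem exists_eq_singleton : ∀ S ∈ bipartitions (Fin 3),
    ∃ i, (∀ j, j ∈ S ↔ j = i) ∨ ∀ j, j ∈ Sᶜ ↔ j = i := by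
  unfold bipartitions; decide

theorem IsLocalAcross.improvedBell_nonpos {S : Finset (Fin 3)} (hS : S ∈ bipartitions (Fin 3))
    {p : Correlation (Fin 3)} (hp : IsLocalAcross S p) : improvedBell p ≤ 0 := by
  obtain ⟨k, q, pS, pT, hq, -, hS', hT', hpq⟩ := hp
  have hcut : ∃ i, (∀ j, j ∈ S ↔ j = i) ∨ ∀ j, j ∈ Sᶜ ↔ j = i := exists_eq_singleton S hS
  have hp : p = fun a x => ∑ l, q l *
      (fun a x => pS l (fun i => a i) (fun i => x i) * pT l (fun i => a i) (fun i => x i)) a x := by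
    ext a x; rw [hpq]; simp only [mul_assoc]
  rw [hp, improvedBell_sum]
  refine Finset.sum_nonpos fun l _ => mul_nonpos_of_nonneg_of_nonpos (hq l) ?_
  obtain ⟨i, h | h⟩ := hcut
  · exact improvedBell_prod_nonpos h (fun j => by rw [Finset.mem_compl, h j]) (hS' l) (hT' l)
  · have h' : ∀ j, j ∈ S ↔ j ≠ i := fun j => by
      rw [Ne, ← h j, Finset.mem_compl, not_not]
    have := improvedBell_prod_nonpos h h' (hT' l) (hS' l)
    simpa only [mul_comm] using this

theorem IsBilocal.improvedBell_nonpos {p : Correlation (Fin 3)} (hp : IsBilocal p) :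
    improvedBell p ≤ 0 := by
  obtain ⟨r, P, hr, -, hP, hpr⟩ := hp
  have hp : p = fun a x => ∑ S ∈ bipartitions (Fin 3), r S * P S a x := by
    ext a x; rw [hpr]
  rw [hp, improvedBell_sum]
  exact Finset.sum_nonpos fun S hS =>
    mul_nonpos_of_nonneg_of_nonpos (hr S hS) ((hP S hS).improvedBell_nonpos hS)

/-! ### Three-qubit tensors and the violation problem -/

open ComplexConjugate

/-- The amplitude tensor of a three-qubit vector contracted with three vectors, extended
linearly. A measurement outcome is represented by the coordinates of its bra, that is, by the
complex conjugates of the coordinates of the measured vector, so that no conjugation appears. -/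
def contract (t : Fin 2 → Fin 2 → Fin 2 → ℂ) (u v w : Fin 2 → ℂ) : ℂ :=
  ∑ i, ∑ j, ∑ k, u i * v j * w k * t i j k

/-- The vector orthogonal to `c` in `ℂ²`, of the same norm. -/
def perp (c : Fin 2 → ℂ) : Fin 2 → ℂ := ![-conj (c 1), conj (c 0)]

/-- The squared Euclidean norm on `ℂ²`. -/
def sqNorm (c : Fin 2 → ℂ) : ℝ := Complex.normSq (c 0) + Complex.normSq (c 1)

/-- The Born weight of the outcome `u ⊗ v ⊗ w`, where the vectors need not be normalized. -/
noncomputable def weight (t : Fin 2 → Fin 2 → Fin 2 → ℂ) (u v w : Fin 2 → ℂ) : ℝ :=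
  Complex.normSq (contract t u v w) / (sqNorm u * sqNorm v * sqNorm w)

/-- The Bell expression of the tensor `t` when party `i` measures in the bases given by
`a i, perp (a i)` for setting `0` and by `b i, perp (b i)` for setting `1`. -/
noncomputable def bellValue (t : Fin 2 → Fin 2 → Fin 2 → ℂ) (a b : Fin 3 → Fin 2 → ℂ) : ℝ :=
  weight t (a 0) (a 1) (a 2) - weight t (perp (b 0)) (a 1) (a 2) - weight t (a 0) (perp (b 1)) (a 2)
    - weight t (a 0) (a 1) (perp (b 2)) - weight t (b 0) (b 1) (a 2) - weight t (b 0) (a 1) (b 2)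

/-- The tensor `t` violates the inequality for suitable local projective measurements. -/
def Violates (t : Fin 2 → Fin 2 → Fin 2 → ℂ) : Prop :=
  ∃ a b : Fin 3 → Fin 2 → ℂ, (∀ i, a i ≠ 0) ∧ (∀ i, b i ≠ 0) ∧ 0 < bellValue t a b

@[simp] theorem perp_zero (c : Fin 2 → ℂ) : perp c 0 = -conj (c 1) := rfl

@[simp] theorem perp_one (c : Fin 2 → ℂ) : perp c 1 = conj (c 0) := rfl

theorem sqNorm_perp (c : Fin 2 → ℂ) : sqNorm (perp c) = sqNorm c := by
  simp [sqNorm, add_comm]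

theorem sqNorm_nonneg (c : Fin 2 → ℂ) : 0 ≤ sqNorm c :=
  add_nonneg (Complex.normSq_nonneg _) (Complex.normSq_nonneg _)

theorem sqNorm_pos {c : Fin 2 → ℂ} : 0 < sqNorm c ↔ c ≠ 0 := by
  refine ⟨fun h e => by simp [e, sqNorm] at h, fun h => ?_⟩
  by_contra h0
  refine h (funext fun i => ?_)
  have h1 := Complex.normSq_nonneg (c 0)
  have h2 := Complex.normSq_nonneg (c 1)
  unfold sqNorm at h0
  fin_cases i
  · exact Complex.normSq_eq_zero.1 (show Complex.normSq (c 0) = 0 by linarith)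
  · exact Complex.normSq_eq_zero.1 (show Complex.normSq (c 1) = 0 by linarith)

theorem sqNorm_smul (z : ℂ) (c : Fin 2 → ℂ) : sqNorm (z • c) = Complex.normSq z * sqNorm c := by
  simp [sqNorm, mul_add]

theorem continuous_sqNorm : Continuous sqNorm := by
  unfold sqNorm
  exact ((Complex.continuous_normSq.comp (continuous_apply 0)).add
    (Complex.continuous_normSq.comp (continuous_apply 1)))

theorem contract_smul_left (t : Fin 2 → Fin 2 → Fin 2 → ℂ) (z : ℂ) (u v w : Fin 2 → ℂ) :
    contract t (z • u) v w = z * contract t u v w := by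
  simp [contract, Fin.sum_univ_two]; ring

theorem contract_smul_mid (t : Fin 2 → Fin 2 → Fin 2 → ℂ) (z : ℂ) (u v w : Fin 2 → ℂ) :
    contract t u (z • v) w = z * contract t u v w := by
  simp [contract, Fin.sum_univ_two]; ring

theorem contract_smul_right (t : Fin 2 → Fin 2 → Fin 2 → ℂ) (z : ℂ) (u v w : Fin 2 → ℂ) :
    contract t u v (z • w) = z * contract t u v w := by
  simp [contract, Fin.sum_univ_two]; ring

theorem weight_smul_left (t : Fin 2 → Fin 2 → Fin 2 → ℂ) {z : ℂ} (hz : z ≠ 0)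
    (u v w : Fin 2 → ℂ) : weight t (z • u) v w = weight t u v w := by
  have := (Complex.normSq_pos.2 hz).ne'
  rw [weight, weight, contract_smul_left, sqNorm_smul, map_mul, mul_assoc, mul_assoc, mul_assoc,
    mul_div_mul_left _ _ this]

theorem weight_smul_mid (t : Fin 2 → Fin 2 → Fin 2 → ℂ) {z : ℂ} (hz : z ≠ 0)
    (u v w : Fin 2 → ℂ) : weight t u (z • v) w = weight t u v w := by
  have := (Complex.normSq_pos.2 hz).ne'
  rw [weight, weight, contract_smul_mid, sqNorm_smul, map_mul,
    show sqNorm u * (Complex.normSq z * sqNorm v) * sqNorm w =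
      Complex.normSq z * (sqNorm u * sqNorm v * sqNorm w) by ring, mul_div_mul_left _ _ this]

theorem weight_smul_right (t : Fin 2 → Fin 2 → Fin 2 → ℂ) {z : ℂ} (hz : z ≠ 0)
    (u v w : Fin 2 → ℂ) : weight t u v (z • w) = weight t u v w := by
  have := (Complex.normSq_pos.2 hz).ne'
  rw [weight, weight, contract_smul_right, sqNorm_smul, map_mul,
    show sqNorm u * sqNorm v * (Complex.normSq z * sqNorm w) =
      Complex.normSq z * (sqNorm u * sqNorm v * sqNorm w) by ring, mul_div_mul_left _ _ this]

/-! ### Local changes of basis -/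

/-- `L` is a multiple of a unitary map of `ℂ²`: it scales the norm by a positive constant and
preserves orthogonality. -/
structure IsSimilitude (L : (Fin 2 → ℂ) → Fin 2 → ℂ) : Prop where
  sqNorm_map : ∃ k : ℝ, 0 < k ∧ ∀ u, sqNorm (L u) = k * sqNorm u
  perp_map : ∃ z : ℂ, z ≠ 0 ∧ ∀ u, perp (L u) = z • L (perp u)

theorem IsSimilitude.map_ne_zero {L : (Fin 2 → ℂ) → Fin 2 → ℂ} (hL : IsSimilitude L)
    {u : Fin 2 → ℂ} (hu : u ≠ 0) : L u ≠ 0 := by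
  obtain ⟨k, hk, h⟩ := hL.sqNorm_map
  rw [← sqNorm_pos, h]
  exact mul_pos hk (sqNorm_pos.2 hu)

theorem Violates.of_similitude {t t' : Fin 2 → Fin 2 → Fin 2 → ℂ}
    {L : Fin 3 → (Fin 2 → ℂ) → Fin 2 → ℂ} (hL : ∀ i, IsSimilitude (L i))
    (h : ∀ u v w, contract t' u v w = contract t (L 0 u) (L 1 v) (L 2 w))
    (ht : Violates t') : Violates t := by
  obtain ⟨a, b, ha, hb, hab⟩ := ht
  refine ⟨fun i => L i (a i), fun i => L i (b i), fun i => (hL i).map_ne_zero (ha i),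
    fun i => (hL i).map_ne_zero (hb i), ?_⟩
  obtain ⟨k₀, hk₀, h₀⟩ := (hL 0).sqNorm_map
  obtain ⟨k₁, hk₁, h₁⟩ := (hL 1).sqNorm_map
  obtain ⟨k₂, hk₂, h₂⟩ := (hL 2).sqNorm_map
  obtain ⟨z₀, hz₀, p₀⟩ := (hL 0).perp_map
  obtain ⟨z₁, hz₁, p₁⟩ := (hL 1).perp_map
  obtain ⟨z₂, hz₂, p₂⟩ := (hL 2).perp_map
  have hw : ∀ u v w, weight t (L 0 u) (L 1 v) (L 2 w) = (k₀ * k₁ * k₂)⁻¹ * weight t' u v w := by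
    intro u v w
    rw [weight, weight, ← h, h₀, h₁, h₂, inv_mul_eq_div, div_div]
    congr 1; ring
  have hv : bellValue t (fun i => L i (a i)) (fun i => L i (b i)) =
      (k₀ * k₁ * k₂)⁻¹ * bellValue t' a b := by
    simp only [bellValue, p₀, p₁, p₂, weight_smul_left t hz₀, weight_smul_mid t hz₁,
      weight_smul_right t hz₂, hw]
    ring
  rw [hv]
  positivity

/-- The similitude that maps the standard basis to `c, perp c`. -/
def rotation (c : Fin 2 → ℂ) (u : Fin 2 → ℂ) : Fin 2 → ℂ := u 0 • c + u 1 • perp c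

theorem isSimilitude_rotation {c : Fin 2 → ℂ} (hc : c ≠ 0) : IsSimilitude (rotation c) := by
  refine ⟨⟨sqNorm c, sqNorm_pos.2 hc, fun u => ?_⟩, ⟨1, one_ne_zero, fun u => ?_⟩⟩
  · have h : ((sqNorm (rotation c u) : ℝ) : ℂ) = ((sqNorm c * sqNorm u : ℝ) : ℂ) := by
      simp [sqNorm, rotation, Complex.normSq_eq_conj_mul_self]
      ring
    exact_mod_cast h
  · ext i
    fin_cases i <;> simp [rotation]
    ring

/-- The diagonal map with entries `α 0, α 1`. -/
def phase (α : Fin 2 → ℂ) (u : Fin 2 → ℂ) : Fin 2 → ℂ := fun i => α i * u i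

theorem isSimilitude_phase {α : Fin 2 → ℂ} (hα : ∀ i, ‖α i‖ = 1) : IsSimilitude (phase α) := by
  have h0 : ∀ i, conj (α i) * α i = 1 := fun i => by
    rw [← Complex.normSq_eq_conj_mul_self, Complex.normSq_eq_norm_sq, hα]; simp
  have hne : ∀ i, α i ≠ 0 := fun i => norm_ne_zero_iff.1 (by rw [hα]; exact one_ne_zero)
  refine ⟨⟨1, one_pos, fun u => ?_⟩, ⟨conj (α 0 * α 1), ?_, fun u => ?_⟩⟩
  · simp [sqNorm, phase, Complex.normSq_eq_norm_sq, hα]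
  · simpa using ⟨hne 0, hne 1⟩
  · ext i
    fin_cases i
    · simp [phase]
      linear_combination (-conj (α 1) * conj (u 1)) * h0 0 
    · simp [phase]
      linear_combination (-conj (α 0) * conj (u 0)) * h0 1

/-! ### Hardy-type violations -/

theorem weight_eq_zero {t : Fin 2 → Fin 2 → Fin 2 → ℂ} {u v w : Fin 2 → ℂ}
    (h : contract t u v w = 0) : weight t u v w = 0 := by
  simp [weight, h]

/-- Hardy-type criterion: once the vectors `a i` of setting `0` are chosen, the vectors of setting
`1` are taken to be the partial contractions of `t` with the `a i`. This makes the outcome `1` of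
setting `1` impossible in the first three negative terms, and it is enough that the remaining two
negative terms vanish. -/
theorem Violates.of_hardy {t : Fin 2 → Fin 2 → Fin 2 → ℂ} (a b : Fin 3 → Fin 2 → ℂ)
    (h : contract t (a 0) (a 1) (a 2) ≠ 0)
    (hb0 : ∀ i, b 0 i = conj (contract t (Pi.single i 1) (a 1) (a 2)))
    (hb1 : ∀ i, b 1 i = conj (contract t (a 0) (Pi.single i 1) (a 2)))
    (hb2 : ∀ i, b 2 i = conj (contract t (a 0) (a 1) (Pi.single i 1)))
    (h1 : contract t (b 0) (b 1) (a 2) = 0) (h2 : contract t (b 0) (a 1) (b 2) = 0) :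
    Violates t := by
  have ha0 : a 0 ≠ 0 := fun e => h (by simp [e, contract])
  have ha1 : a 1 ≠ 0 := fun e => h (by simp [e, contract])
  have ha2 : a 2 ≠ 0 := fun e => h (by simp [e, contract])
  have e0 : contract t (a 0) (a 1) (a 2) = a 0 0 * conj (b 0 0) + a 0 1 * conj (b 0 1) := by
    simp [hb0, contract, Fin.sum_univ_two]; ring
  have e1 : contract t (a 0) (a 1) (a 2) = a 1 0 * conj (b 1 0) + a 1 1 * conj (b 1 1) := by
    simp [hb1, contract, Fin.sum_univ_two]; ring
  have e2 : contract t (a 0) (a 1) (a 2) = a 2 0 * conj (b 2 0) + a 2 1 * conj (b 2 1) := by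
    simp [hb2, contract, Fin.sum_univ_two]; ring
  have hb0' : b 0 ≠ 0 := fun e => h (by rw [e0]; simp [e])
  have hb1' : b 1 ≠ 0 := fun e => h (by rw [e1]; simp [e])
  have hb2' : b 2 ≠ 0 := fun e => h (by rw [e2]; simp [e])
  refine ⟨a, b, ?_, ?_, ?_⟩
  · rw [Fin.forall_fin_succ, Fin.forall_fin_two]; exact ⟨ha0, ha1, ha2⟩
  · rw [Fin.forall_fin_succ, Fin.forall_fin_two]; exact ⟨hb0', hb1', hb2'⟩
  have z0 : contract t (perp (b 0)) (a 1) (a 2) = 0 := by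
    simp only [contract, Fin.sum_univ_two, perp_zero, perp_one, hb0]
    simp; ring
  have z1 : contract t (a 0) (perp (b 1)) (a 2) = 0 := by
    simp only [contract, Fin.sum_univ_two, perp_zero, perp_one, hb1]
    simp; ring
  have z2 : contract t (a 0) (a 1) (perp (b 2)) = 0 := by
    simp only [contract, Fin.sum_univ_two, perp_zero, perp_one, hb2]
    simp; ring
  rw [bellValue, weight_eq_zero z0, weight_eq_zero z1, weight_eq_zero z2, weight_eq_zero h1,
    weight_eq_zero h2]
  simp only [sub_zero, weight]
  exact div_pos (Complex.normSq_pos.2 h)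
    (mul_pos (mul_pos (sqNorm_pos.2 ha0) (sqNorm_pos.2 ha1)) (sqNorm_pos.2 ha2))

/-! ### Real solutions of the Hardy conditions -/

/-- Solvability of the Hardy equation for the tensor `t 0 1 0 = s`, `t 1 0 1 = r`, `t 0 1 1 = -p`,
`t 1 1 1 = q`, where `S = s² + p²` and `R = r² + q²`. The equation says that `P b` and `P' b` are
parallel, for `b = (Y, X)` the direction of the vector of party `0` for setting `1` and `P`, `P'`
the states of party `0` conditional on the outcomes `0` of party `2` and of party `1`. The
amplitude `-p` is nonpositive so that in `X` the only negative contributions are of low degree. -/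
theorem exists_root_orthogonal {p q S R : ℝ} (hp : 0 ≤ p) (hq : 0 ≤ q) (hS : 0 < S) (hR : 0 < R)
    {Y : ℝ} (hY : 0 < Y) : ∃ X : ℝ, 0 < X ∧
      -(p * X * (Y ^ 4 - R * X ^ 2)) + X * Y * (X ^ 2 * Y ^ 2 - S * R)
        + q * Y * (X ^ 4 - S * Y ^ 2) = 0 := by
  rcases hq.eq_or_lt with rfl | hq
  · refine ⟨√((p * Y ^ 4 + S * R * Y) / (p * R + Y ^ 3)), by positivity, ?_⟩
    set X := √((p * Y ^ 4 + S * R * Y) / (p * R + Y ^ 3)) with hX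
    have h2 : X ^ 2 = (p * Y ^ 4 + S * R * Y) / (p * R + Y ^ 3) := Real.sq_sqrt (by positivity)
    have h3 : X ^ 2 * (p * R + Y ^ 3) = p * Y ^ 4 + S * R * Y := by
      rw [h2]; field_simp
    linear_combination X * h3
  · set f : ℝ → ℝ := fun X => -(p * X * (Y ^ 4 - R * X ^ 2)) + X * Y * (X ^ 2 * Y ^ 2 - S * R)
        + q * Y * (X ^ 4 - S * Y ^ 2) with hf
    have h0 : f 0 < 0 := by
      have : 0 < q * S * Y ^ 3 := by positivity
      simp only [hf]; nlinarith
    set c := (p * Y ^ 4 + S * R * Y + q * S * Y ^ 3) / Y ^ 3 with hc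
    have hc0 : 0 ≤ c := by positivity
    have hcY : c * Y ^ 3 = p * Y ^ 4 + S * R * Y + q * S * Y ^ 3 := by
      rw [hc]; field_simp
    have h1 : 0 ≤ f (1 + c) := by
      have e : f (1 + c) = (1 + c) * ((1 + c) ^ 2 - c) * Y ^ 3 + c * q * S * Y ^ 3
          + (p * R * (1 + c) ^ 3 + q * Y * (1 + c) ^ 4) := by
        simp only [hf]; linear_combination (1 + c) * hcY
      rw [e]
      have : 0 ≤ (1 + c) ^ 2 - c := by nlinarith
      positivity
    obtain ⟨X, hX, hX0⟩ := intermediate_value_Icc (by linarith : (0 : ℝ) ≤ 1 + c)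
      (by fun_prop : Continuous f).continuousOn ⟨h0.le, h1⟩
    refine ⟨X, lt_of_le_of_ne hX.1 ?_, hX0⟩
    rintro rfl
    exact h0.ne hX0

/-- Among the solutions of the Hardy equation of `exists_root_orthogonal` there is one for which
the amplitude of the positive term is nonzero, that is, `b` is not an eigenvector of `P`. The
choice of `Y`, above `√R` if `R ≤ S` and below `√R` if `S ≤ R`, rules out common eigenvectors of
`P` and `P'`. -/
theorem exists_hardy_orthogonal {p q S R : ℝ} (hp : 0 ≤ p) (hq : 0 ≤ q) (hS : 0 < S) (hR : 0 < R)
    (hqR : q ^ 2 < R) : ∃ X Y : ℝ, 0 < X ∧ 0 < Y ∧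
      -(p * X * (Y ^ 4 - R * X ^ 2)) + X * Y * (X ^ 2 * Y ^ 2 - S * R)
        + q * Y * (X ^ 4 - S * Y ^ 2) = 0 ∧
      q * (Y ^ 2 - X ^ 2) + X * (R - Y ^ 2) ≠ 0 := by
  obtain ⟨ρ, hρ, hρR⟩ : ∃ ρ : ℝ, 0 < ρ ∧ ρ ^ 2 = R := ⟨√R, Real.sqrt_pos.2 hR, Real.sq_sqrt hR.le⟩
  have hqρ : q < ρ := lt_of_pow_lt_pow_left₀ 2 hρ.le (by rwa [hρR])
  -- If `b` is an eigenvector of `P`, then by the Hardy equation it is an eigenvector of `P'` too.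
  have key : ∀ X Y : ℝ, 0 < X → 0 < Y →
      -(p * X * (Y ^ 4 - R * X ^ 2)) + X * Y * (X ^ 2 * Y ^ 2 - S * R)
        + q * Y * (X ^ 4 - S * Y ^ 2) = 0 →
      q * (Y ^ 2 - X ^ 2) + X * (R - Y ^ 2) = 0 → p * (Y ^ 2 - X ^ 2) = Y * (X ^ 2 - S) := by
    intro X Y hX hY hG hb
    have hne : (Y ^ 2 + q * X) * X ≠ 0 := by positivity
    have : (Y ^ 2 + q * X) * X * (Y * (X ^ 2 - S) - p * (Y ^ 2 - X ^ 2)) = 0 := by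
      linear_combination hG + (S * Y - p * X ^ 2) * hb
    have := (mul_eq_zero.1 this).resolve_left hne
    linarith
  rcases le_total R S with h | h
  · obtain ⟨X, hX, hG⟩ := exists_root_orthogonal hp hq hS hR (by linarith : 0 < ρ + 1)
    refine ⟨X, ρ + 1, hX, by linarith, hG, fun hb => ?_⟩
    have h2 := key X (ρ + 1) hX (by linarith) hG hb
    set Y := ρ + 1 with hY
    have hYρ : R < Y ^ 2 := by nlinarith
    rcases lt_trichotomy X Y with hXY | hXY | hXY
    · have hd : 0 < Y ^ 2 - X ^ 2 := by nlinarith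
      have hXS : S ≤ X ^ 2 := by
        have := mul_nonneg hp hd.le
        have : 0 ≤ X ^ 2 - S := nonneg_of_mul_nonneg_right (h2 ▸ this) (by linarith)
        linarith
      have hXρ : ρ ≤ X := by nlinarith
      have : 0 ≤ (X - ρ) * (Y ^ 2 + X * ρ) := mul_nonneg (by linarith) (by positivity)
      nlinarith [mul_pos (sub_pos.2 hqρ) hd]
    · rw [hXY] at hb
      have : (ρ + 1) * (R - Y ^ 2) = 0 := by rw [← hY]; linarith
      rcases mul_eq_zero.1 this with h0 | h0 <;> linarith
    · have hd : 0 < X ^ 2 - Y ^ 2 := by nlinarith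
      nlinarith [mul_nonneg hq hd.le, mul_pos hX (sub_pos.2 hYρ)]
  · obtain ⟨X, hX, hG⟩ := exists_root_orthogonal hp hq hS hR (by linarith : 0 < ρ / 2)
    refine ⟨X, ρ / 2, hX, by linarith, hG, fun hb => ?_⟩
    have h2 := key X (ρ / 2) hX (by linarith) hG hb
    set Y := ρ / 2 with hY
    have hY0 : 0 < Y := by linarith
    have hYρ : Y ^ 2 < R := by nlinarith
    rcases lt_trichotomy X Y with hXY | hXY | hXY
    · have hd : 0 < Y ^ 2 - X ^ 2 := by nlinarith
      nlinarith [mul_nonneg hq hd.le, mul_pos hX (sub_pos.2 hYρ)]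
    · rw [hXY] at hb
      have : Y * (R - Y ^ 2) = 0 := by linarith
      rcases mul_eq_zero.1 this with h0 | h0 <;> linarith
    · have hd : 0 < X ^ 2 - Y ^ 2 := by nlinarith
      have hXS : X ^ 2 ≤ S := by
        have := mul_nonneg hp hd.le
        have : 0 ≤ S - X ^ 2 := nonneg_of_mul_nonneg_right (by linarith : 0 ≤ Y * (S - X ^ 2)) hY0
        linarith
      have hXρ : X ≤ ρ := by nlinarith
      have : 0 ≤ (ρ - X) * (Y ^ 2 + X * ρ) := mul_nonneg (by linarith) (by positivity)
      nlinarith [mul_pos (sub_pos.2 hqρ) hd]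

theorem exists_root_cubic (a b c : ℝ) : ∃ x : ℝ, x ^ 3 + a * x ^ 2 + b * x + c = 0 := by
  set f : ℝ → ℝ := fun x => x ^ 3 + a * x ^ 2 + b * x + c with hf
  set m := 1 + |a| + |b| + |c| with hm
  have ha := abs_nonneg a
  have hb := abs_nonneg b
  have hc := abs_nonneg c
  have hm1 : 1 ≤ m := by linarith
  have hm2 : m ≤ m ^ 2 := by nlinarith
  have e : m ^ 3 = m ^ 2 + |a| * m ^ 2 + |b| * m ^ 2 + |c| * m ^ 2 := by rw [hm]; ring
  have hab : |a| * m ^ 2 ≥ |a * m ^ 2| := by rw [abs_mul, abs_of_nonneg (sq_nonneg m)]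
  have hbb : |b| * m ^ 2 ≥ |b * m| := by
    rw [abs_mul, abs_of_nonneg (by linarith : 0 ≤ m)]; gcongr
  have hcb : |c| * m ^ 2 ≥ |c| := by nlinarith
  have h1 : f (-m) ≤ 0 := by
    simp only [hf]
    nlinarith [le_abs_self (a * m ^ 2), neg_abs_le (b * m), le_abs_self c]
  have h2 : 0 ≤ f m := by
    simp only [hf]
    nlinarith [neg_abs_le (a * m ^ 2), neg_abs_le (b * m), neg_abs_le c]
  obtain ⟨x, -, hx⟩ := intermediate_value_Icc (by linarith : -m ≤ m)
    (by fun_prop : Continuous f).continuousOn ⟨h1, h2⟩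
  exact ⟨x, hx⟩

/-- The Hardy equation for the tensor `t 0 1 0 = α`, `t 0 0 1 = β`, `t 0 1 1 = p`, `t 1 1 1 = q`
has a solution for which the amplitude of the positive term is nonzero. As in
`exists_root_orthogonal`, the equation says that the conditional states `P`, `P'` of party `0` map
`b = (Z, q)` to parallel vectors, and the inequality that `b` is not an eigenvector of `P`. -/
theorem exists_hardy_parallel {α β p q : ℝ} (hα : 0 < α) (hβ : 0 < β) (hp : 0 ≤ p)
    (hq : 0 < q) : ∃ X Y Z : ℝ, Z = X + Y - p ∧
      ((β ^ 2 + Y ^ 2) * Z + q ^ 2 * Y) * (X * Z + q ^ 2)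
        - ((α ^ 2 + X ^ 2) * Z + q ^ 2 * X) * (Y * Z + q ^ 2) = 0 ∧
      (β ^ 2 + Y ^ 2) * Z + q ^ 2 * Y - (Y * Z + q ^ 2) * Z ≠ 0 := by
  rcases hp.eq_or_lt with rfl | hp
  swap
  · exact ⟨p / 2, p / 2, 0, by ring, by ring, by simp; exact ⟨hq.ne', hp.ne'⟩⟩
  -- For every `Z > 0` there is a solution; it can be degenerate only for one value of `Z`.
  have key : ∀ Z : ℝ, 0 < Z → ∃ X Y : ℝ, Z = X + Y - 0 ∧
      ((β ^ 2 + Y ^ 2) * Z + q ^ 2 * Y) * (X * Z + q ^ 2)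
        - ((α ^ 2 + X ^ 2) * Z + q ^ 2 * X) * (Y * Z + q ^ 2) = 0 ∧
      ((β ^ 2 + Y ^ 2) * Z + q ^ 2 * Y - (Y * Z + q ^ 2) * Z = 0 →
        Z ^ 2 * (q ^ 4 - (β ^ 2 - α ^ 2) ^ 2) = 2 * q ^ 4 * (α ^ 2 + β ^ 2 - q ^ 2)) := by
    intro Z hZ
    obtain ⟨D, hD⟩ := exists_root_cubic 0
      (4 * (Z * (β ^ 2 + α ^ 2) / 2 * Z - Z ^ 4 / 4 - q ^ 2 * Z ^ 2 - q ^ 4) / Z ^ 2)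
      (4 * (Z ^ 3 * (β ^ 2 - α ^ 2) / 2 + q ^ 2 * Z * (β ^ 2 - α ^ 2)) / Z ^ 2)
    have hF : ((β ^ 2 + ((Z - D) / 2) ^ 2) * Z + q ^ 2 * ((Z - D) / 2)) *
          ((Z + D) / 2 * Z + q ^ 2)
        - ((α ^ 2 + ((Z + D) / 2) ^ 2) * Z + q ^ 2 * ((Z + D) / 2)) *
          ((Z - D) / 2 * Z + q ^ 2) = 0 := by
      field_simp at hD
      linear_combination hD / 8
    refine ⟨(Z + D) / 2, (Z - D) / 2, by ring, hF, ?_⟩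
    generalize hXe : (Z + D) / 2 = X at *
    generalize hYe : (Z - D) / 2 = Y at *
    have hXY : Z = X + Y := by linarith
    intro hb
    have hne : Y * Z + q ^ 2 ≠ 0 := fun h0 => by
      have : β ^ 2 * Z = 0 := by linear_combination hb + (Z - Y) * h0
      have : 0 < β ^ 2 * Z := by positivity
      linarith
    have hb' : (α ^ 2 + X ^ 2) * Z + q ^ 2 * X - (X * Z + q ^ 2) * Z = 0 := by
      have : (Y * Z + q ^ 2) * ((α ^ 2 + X ^ 2) * Z + q ^ 2 * X - (X * Z + q ^ 2) * Z) = 0 := by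
        linear_combination (X * Z + q ^ 2) * hb - hF
      exact (mul_eq_zero.1 this).resolve_left hne
    have e1 : q ^ 2 * (X - Y) = (β ^ 2 - α ^ 2) * Z := by
      subst hXY; linear_combination hb' - hb
    have e2 : 2 * X * Y = α ^ 2 + β ^ 2 - q ^ 2 := by
      have : Z * (2 * X * Y - (α ^ 2 + β ^ 2 - q ^ 2)) = 0 := by
        subst hXY; linear_combination -hb' - hb
      have := (mul_eq_zero.1 this).resolve_left hZ.ne'
      linarith
    rw [← e2]
    have e3 : ((β ^ 2 - α ^ 2) * Z) ^ 2 = (q ^ 2 * (X - Y)) ^ 2 := by rw [e1]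
    subst hXY
    linear_combination -e3
  obtain ⟨X₁, Y₁, h₁, hF₁, hb₁⟩ := key 1 one_pos
  obtain ⟨X₂, Y₂, h₂, hF₂, hb₂⟩ := key 2 two_pos
  by_cases c₁ : (β ^ 2 + Y₁ ^ 2) * 1 + q ^ 2 * Y₁ - (Y₁ * 1 + q ^ 2) * 1 = 0
  swap
  · exact ⟨X₁, Y₁, 1, h₁, hF₁, c₁⟩
  by_cases c₂ : (β ^ 2 + Y₂ ^ 2) * 2 + q ^ 2 * Y₂ - (Y₂ * 2 + q ^ 2) * 2 = 0
  swap
  · exact ⟨X₂, Y₂, 2, h₂, hF₂, c₂⟩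
  exfalso
  have g₁ := hb₁ c₁
  have g₂ := hb₂ c₂
  have k₁ : q ^ 4 = (β ^ 2 - α ^ 2) ^ 2 := by linarith
  have k₂ : q ^ 4 * (α ^ 2 + β ^ 2 - q ^ 2) = 0 := by linarith
  have k₃ := (mul_eq_zero.1 k₂).resolve_left (by positivity)
  have k₄ : q ^ 2 = α ^ 2 + β ^ 2 := by linarith
  have : 4 * α ^ 2 * β ^ 2 = 0 := by
    linear_combination k₁ - (q ^ 2 + α ^ 2 + β ^ 2) * k₄
  have : 0 < 4 * α ^ 2 * β ^ 2 := by positivity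
  linarith

/-! ### Violation in the exceptional cases -/

theorem violates_of_orthogonal_real {t : Fin 2 → Fin 2 → Fin 2 → ℂ} {s r p q : ℝ} (hs : 0 < s)
    (hr : 0 < r) (hp : 0 ≤ p) (hq : 0 ≤ q) (h000 : t 0 0 0 = 0) (h100 : t 1 0 0 = 0)
    (h110 : t 1 1 0 = 0) (h001 : t 0 0 1 = 0) (h010 : t 0 1 0 = s) (h101 : t 1 0 1 = r)
    (h011 : t 0 1 1 = -p) (h111 : t 1 1 1 = q) : Violates t := by
  -- For the vectors `v`, `w` of parties `1` and `2`, party `0` is left with a multiple of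
  -- `b = (Y, X)`; its vector `u` is chosen orthogonal to `P b`.
  obtain ⟨X, Y, hX, hY, hG, hne⟩ := exists_hardy_orthogonal (S := s ^ 2 + p ^ 2)
    (R := r ^ 2 + q ^ 2) hp hq (by positivity) (by positivity) (by nlinarith)
  have hG' := congrArg (fun x : ℝ => (x : ℂ)) hG
  push_cast at hG'
  have hne' : r * s * Y * (q * (Y ^ 2 - X ^ 2) + X * (r ^ 2 + q ^ 2 - Y ^ 2)) ≠ 0 :=
    mul_ne_zero (by positivity) hne
  set u : Fin 2 → ℂ := ![-(q * Y ^ 2 + (r ^ 2 + q ^ 2) * X), Y ^ 3 + q * X * Y] with hu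
  set v : Fin 2 → ℂ := ![X - q, r] with hv
  set w : Fin 2 → ℂ := ![Y + p, s] with hw
  refine Violates.of_hardy ![u, v, w]
    ![fun i => conj (contract t (Pi.single i 1) v w),
      fun i => conj (contract t u (Pi.single i 1) w),
      fun i => conj (contract t u v (Pi.single i 1))] ?_ (fun i => rfl) (fun i => rfl)
      (fun i => rfl) ?_ ?_
  · intro h0
    apply hne'
    have : ((r * s * Y * (q * (Y ^ 2 - X ^ 2) + X * (r ^ 2 + q ^ 2 - Y ^ 2)) : ℝ) : ℂ) = 0 := by
      simp [contract, Fin.sum_univ_two, hu, hv, hw, h000, h100, h110, h001, h010, h101, h011,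
        h111] at h0
      push_cast
      linear_combination -h0
    exact_mod_cast this
  · simp [contract, Fin.sum_univ_two, hu, hv, hw, h000, h100, h110, h001, h010, h101, h011, h111]
    ring
  · simp [contract, Fin.sum_univ_two, hu, hv, hw, h000, h100, h110, h001, h010, h101, h011, h111]
    linear_combination r ^ 3 * s * hG'

theorem violates_of_parallel_real {t : Fin 2 → Fin 2 → Fin 2 → ℂ} {α β p q : ℝ} (hα : 0 < α)
    (hβ : 0 < β) (hp : 0 ≤ p) (hq : 0 < q) (h000 : t 0 0 0 = 0) (h100 : t 1 0 0 = 0)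
    (h110 : t 1 1 0 = 0) (h101 : t 1 0 1 = 0) (h010 : t 0 1 0 = α) (h001 : t 0 0 1 = β)
    (h011 : t 0 1 1 = p) (h111 : t 1 1 1 = q) : Violates t := by
  -- For the vectors `v`, `w` of parties `1` and `2`, party `0` is left with a multiple of
  -- `b = (Z, q)`; its vector `u` is chosen orthogonal to `P b`.
  obtain ⟨X, Y, Z, hZ, hG, hne⟩ := exists_hardy_parallel hα hβ hp hq
  have hG' := congrArg (fun x : ℝ => (x : ℂ)) hG
  have hZ' := congrArg (fun x : ℝ => (x : ℂ)) hZ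
  push_cast at hG' hZ'
  have hne' : α * β * q * ((β ^ 2 + Y ^ 2) * Z + q ^ 2 * Y - (Y * Z + q ^ 2) * Z) ≠ 0 :=
    mul_ne_zero (by positivity) hne
  set u : Fin 2 → ℂ := ![-(q * (Y * Z + q ^ 2)), (β ^ 2 + Y ^ 2) * Z + q ^ 2 * Y] with hu
  set v : Fin 2 → ℂ := ![X - p, β] with hv
  set w : Fin 2 → ℂ := ![Y - p, α] with hw
  refine Violates.of_hardy ![u, v, w]
    ![fun i => conj (contract t (Pi.single i 1) v w),
      fun i => conj (contract t u (Pi.single i 1) w),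
      fun i => conj (contract t u v (Pi.single i 1))] ?_ (fun i => rfl) (fun i => rfl)
      (fun i => rfl) ?_ ?_
  · intro h0
    apply hne'
    have : ((α * β * q * ((β ^ 2 + Y ^ 2) * Z + q ^ 2 * Y - (Y * Z + q ^ 2) * Z) : ℝ) : ℂ)
        = 0 := by
      simp [contract, Fin.sum_univ_two, hu, hv, hw, h000, h100, h110, h001, h010, h101, h011,
        h111] at h0
      push_cast
      rw [hZ'] at h0 ⊢
      linear_combination h0
    exact_mod_cast this
  · simp [contract, Fin.sum_univ_two, hu, hv, hw, h000, h100, h110, h001, h010, h101, h011, h111]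
    rw [hZ']
    ring
  · rw [hZ'] at hG'
    simp [contract, Fin.sum_univ_two, hu, hv, hw, h000, h100, h110, h001, h010, h101, h011, h111]
    rw [hZ']
    linear_combination α * β ^ 3 * q * hG'

/-- A complex number of modulus one that rotates `z` to its modulus. -/
theorem exists_phase (z : ℂ) : ∃ u : ℂ, ‖u‖ = 1 ∧ u * z = ‖z‖ := by
  rcases eq_or_ne z 0 with rfl | hz
  · exact ⟨1, by simp, by simp⟩
  · have hz' : (‖z‖ : ℂ) ≠ 0 := by exact_mod_cast norm_ne_zero_iff.2 hz
    refine ⟨conj z / ‖z‖, ?_, ?_⟩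
    · rw [norm_div, RCLike.norm_conj, Complex.norm_real, norm_norm,
        div_self (norm_ne_zero_iff.2 hz)]
    · rw [div_mul_eq_mul_div, ← Complex.normSq_eq_conj_mul_self, Complex.normSq_eq_norm_sq]
      push_cast
      field_simp

theorem contract_phase (t : Fin 2 → Fin 2 → Fin 2 → ℂ) (α β γ u v w : Fin 2 → ℂ) :
    contract (fun i j k => α i * β j * γ k * t i j k) u v w =
      contract t (phase α u) (phase β v) (phase γ w) := by
  simp only [contract, phase]
  refine Finset.sum_congr rfl fun i _ => Finset.sum_congr rfl fun j _ =>
    Finset.sum_congr rfl fun k _ => ?_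
  ring

theorem Violates.of_phase {t : Fin 2 → Fin 2 → Fin 2 → ℂ} {α β γ : Fin 2 → ℂ}
    (hα : ∀ i, ‖α i‖ = 1) (hβ : ∀ i, ‖β i‖ = 1) (hγ : ∀ i, ‖γ i‖ = 1)
    (h : Violates fun i j k => α i * β j * γ k * t i j k) : Violates t :=
  h.of_similitude (L := ![phase α, phase β, phase γ])
    (Fin.forall_fin_succ.2 ⟨isSimilitude_phase hα, Fin.forall_fin_two.2
      ⟨isSimilitude_phase hβ, isSimilitude_phase hγ⟩⟩) (contract_phase t α β γ)

/-- Violation when the amplitude vectors `t · 1 0` and `t · 0 1` are orthogonal. -/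
theorem violates_of_orthogonal {t : Fin 2 → Fin 2 → Fin 2 → ℂ} (h000 : t 0 0 0 = 0)
    (h100 : t 1 0 0 = 0) (h110 : t 1 1 0 = 0) (h001 : t 0 0 1 = 0) (h010 : t 0 1 0 ≠ 0)
    (h101 : t 1 0 1 ≠ 0) : Violates t := by
  obtain ⟨a, ha, ha'⟩ := exists_phase (t 0 1 0)
  obtain ⟨b, hb, hb'⟩ := exists_phase (t 0 1 1)
  obtain ⟨c, hc, hc'⟩ := exists_phase (t 1 1 1)
  obtain ⟨d, hd, hd'⟩ := exists_phase (t 1 0 1)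
  have hb0 : b ≠ 0 := norm_ne_zero_iff.1 (by rw [hb]; exact one_ne_zero)
  have hc0 : c ≠ 0 := norm_ne_zero_iff.1 (by rw [hc]; exact one_ne_zero)
  -- The sign of the amplitude `011` is made nonpositive, the others nonnegative.
  refine Violates.of_phase (α := ![1, -(c / b)]) (β := ![d / c, 1]) (γ := ![a, -b]) ?_ ?_ ?_ ?_
  · rw [Fin.forall_fin_two]; simp [hb, hc]
  · rw [Fin.forall_fin_two]; simp [hd, hc]
  · rw [Fin.forall_fin_two]; simp [ha, hb]
  · refine violates_of_orthogonal_real (norm_pos_iff.2 h010) (norm_pos_iff.2 h101)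
      (norm_nonneg (t 0 1 1)) (norm_nonneg (t 1 1 1)) ?_ ?_ ?_ ?_ ?_ ?_ ?_ ?_
    · simp [h000]
    · simp [h100]
    · simp [h110]
    · simp [h001]
    · simpa using ha'
    · simp only [Matrix.cons_val_one, Matrix.cons_val_zero]
      rw [← hd']; field_simp
    · simpa using hb'
    · simp only [Matrix.cons_val_one, Matrix.cons_val_zero]
      rw [← hc']; field_simp

/-- Violation when the amplitude vectors `t · 1 0` and `t · 0 1` are parallel. -/
theorem violates_of_parallel {t : Fin 2 → Fin 2 → Fin 2 → ℂ} (h000 : t 0 0 0 = 0)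
    (h100 : t 1 0 0 = 0) (h110 : t 1 1 0 = 0) (h101 : t 1 0 1 = 0) (h010 : t 0 1 0 ≠ 0)
    (h001 : t 0 0 1 ≠ 0) (h111 : t 1 1 1 ≠ 0) : Violates t := by
  obtain ⟨a, ha, ha'⟩ := exists_phase (t 0 1 0)
  obtain ⟨b, hb, hb'⟩ := exists_phase (t 0 1 1)
  obtain ⟨c, hc, hc'⟩ := exists_phase (t 1 1 1)
  obtain ⟨d, hd, hd'⟩ := exists_phase (t 0 0 1)
  have hb0 : b ≠ 0 := norm_ne_zero_iff.1 (by rw [hb]; exact one_ne_zero)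
  refine Violates.of_phase (α := ![1, c / b]) (β := ![d / b, 1]) (γ := ![a, b]) ?_ ?_ ?_ ?_
  · rw [Fin.forall_fin_two]; simp [hb, hc]
  · rw [Fin.forall_fin_two]; simp [hd, hb]
  · rw [Fin.forall_fin_two]; simp [ha, hb]
  · refine violates_of_parallel_real (norm_pos_iff.2 h010) (norm_pos_iff.2 h001)
      (norm_nonneg (t 0 1 1)) (norm_pos_iff.2 h111) ?_ ?_ ?_ ?_ ?_ ?_ ?_ ?_
    · simp [h000]
    · simp [h100]
    · simp [h110]
    · simp [h101]
    · simpa using ha'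
    · simp only [Matrix.cons_val_one, Matrix.cons_val_zero]
      rw [← hd']; field_simp
    · simpa using hb'
    · simp only [Matrix.cons_val_one, Matrix.cons_val_zero]
      rw [← hc']; field_simp

/-! ### Violation in the generic case -/

open Filter Topology

/-- Perturbative criterion: along a curve of measurements on which all six amplitudes vanish at
`0`, the inequality is violated close to `0` if to first order only the amplitude of the positive
term is nonzero. -/
theorem Violates.of_curve {t : Fin 2 → Fin 2 → Fin 2 → ℂ} (a b : ℝ → Fin 3 → Fin 2 → ℂ)
    (B : Fin 6 → ℝ → ℂ) (ha : Continuous a) (hb : Continuous b) (hB : ∀ k, Continuous (B k))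
    (ha0 : ∀ i, a 0 i ≠ 0) (hb0 : ∀ i, b 0 i ≠ 0)
    (h0 : ∀ x : ℝ, contract t (a x 0) (a x 1) (a x 2) = x * B 0 x)
    (h1 : ∀ x : ℝ, contract t (perp (b x 0)) (a x 1) (a x 2) = x * B 1 x)
    (h2 : ∀ x : ℝ, contract t (a x 0) (perp (b x 1)) (a x 2) = x * B 2 x)
    (h3 : ∀ x : ℝ, contract t (a x 0) (a x 1) (perp (b x 2)) = x * B 3 x)
    (h4 : ∀ x : ℝ, contract t (b x 0) (b x 1) (a x 2) = x * B 4 x)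
    (h5 : ∀ x : ℝ, contract t (b x 0) (a x 1) (b x 2) = x * B 5 x)
    (hB0 : B 0 0 ≠ 0) (hB1 : B 1 0 = 0) (hB2 : B 2 0 = 0) (hB3 : B 3 0 = 0) (hB4 : B 4 0 = 0)
    (hB5 : B 5 0 = 0) : Violates t := by
  have ca : ∀ i, Continuous fun x => sqNorm (a x i) := fun i =>
    continuous_sqNorm.comp ((continuous_apply i).comp ha)
  have cb : ∀ i, Continuous fun x => sqNorm (b x i) := fun i =>
    continuous_sqNorm.comp ((continuous_apply i).comp hb)
  have na : ∀ i, sqNorm (a 0 i) ≠ 0 := fun i => (sqNorm_pos.2 (ha0 i)).ne'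
  have nb : ∀ i, sqNorm (b 0 i) ≠ 0 := fun i => (sqNorm_pos.2 (hb0 i)).ne'
  have cB : ∀ k, Continuous fun x => Complex.normSq (B k x) := fun k =>
    Complex.continuous_normSq.comp (hB k)
  have hdiv : ∀ k {N : ℝ → ℝ}, Continuous N → N 0 ≠ 0 →
      ContinuousAt (fun x => Complex.normSq (B k x) / N x) 0 := fun k _ hN hN0 =>
    (cB k).continuousAt.div hN.continuousAt hN0
  set g : ℝ → ℝ := fun x =>
    Complex.normSq (B 0 x) / (sqNorm (a x 0) * sqNorm (a x 1) * sqNorm (a x 2))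
    - Complex.normSq (B 1 x) / (sqNorm (b x 0) * sqNorm (a x 1) * sqNorm (a x 2))
    - Complex.normSq (B 2 x) / (sqNorm (a x 0) * sqNorm (b x 1) * sqNorm (a x 2))
    - Complex.normSq (B 3 x) / (sqNorm (a x 0) * sqNorm (a x 1) * sqNorm (b x 2))
    - Complex.normSq (B 4 x) / (sqNorm (b x 0) * sqNorm (b x 1) * sqNorm (a x 2))
    - Complex.normSq (B 5 x) / (sqNorm (b x 0) * sqNorm (a x 1) * sqNorm (b x 2)) with hg
  have hval : ∀ x, bellValue t (a x) (b x) = x ^ 2 * g x := fun x => by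
    simp only [bellValue, weight, h0, h1, h2, h3, h4, h5, sqNorm_perp, map_mul,
      Complex.normSq_ofReal, hg]
    ring
  have hgc : ContinuousAt g 0 := by
    refine ((((((hdiv 0 ?_ ?_).sub (hdiv 1 ?_ ?_)).sub (hdiv 2 ?_ ?_)).sub (hdiv 3 ?_ ?_)).sub
      (hdiv 4 ?_ ?_)).sub (hdiv 5 ?_ ?_))
    all_goals first
      | exact ((ca _).mul (ca _)).mul (ca _)
      | exact ((cb _).mul (ca _)).mul (ca _)
      | exact ((ca _).mul (cb _)).mul (ca _)
      | exact ((ca _).mul (ca _)).mul (cb _)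
      | exact ((cb _).mul (cb _)).mul (ca _)
      | exact ((cb _).mul (ca _)).mul (cb _)
      | simp [na, nb]
  have hg0 : 0 < g 0 := by
    simp only [hg, hB1, hB2, hB3, hB4, hB5, map_zero, zero_div, sub_zero]
    exact div_pos (Complex.normSq_pos.2 hB0) (mul_pos (mul_pos (sqNorm_pos.2 (ha0 0))
      (sqNorm_pos.2 (ha0 1))) (sqNorm_pos.2 (ha0 2)))
  have hev : ∀ᶠ x in 𝓝[≠] (0 : ℝ), 0 < g x ∧ (∀ i, a x i ≠ 0) ∧ ∀ i, b x i ≠ 0 := by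
    refine Filter.Eventually.filter_mono nhdsWithin_le_nhds ?_
    refine (hgc.eventually (lt_mem_nhds hg0)).and ((eventually_all.2 fun i => ?_).and
      (eventually_all.2 fun i => ?_))
    · exact (((continuous_apply i).comp ha).continuousAt.eventually_ne (ha0 i))
    · exact (((continuous_apply i).comp hb).continuousAt.eventually_ne (hb0 i))
  obtain ⟨x, ⟨hx, hax, hbx⟩, hx0⟩ := (hev.and self_mem_nhdsWithin).exists
  refine ⟨a x, b x, hax, hbx, ?_⟩
  rw [hval]
  have hx0 : x ≠ 0 := hx0
  positivity

/-- Violation when the amplitude vectors `t · 1 0` and `t · 0 1` are neither parallel nor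
orthogonal. -/
theorem violates_of_generic {t : Fin 2 → Fin 2 → Fin 2 → ℂ} (h000 : t 0 0 0 = 0)
    (h100 : t 1 0 0 = 0) (h110 : t 1 1 0 = 0) (h010 : t 0 1 0 ≠ 0) (h001 : t 0 0 1 ≠ 0)
    (h101 : t 1 0 1 ≠ 0) : Violates t := by
  -- With `v = t · 1 0` and `w = t · 0 1`, the curve starts at the vectors `w^⊥, 0, 0` for setting
  -- `0` and `v^⊥, 1, 0` for setting `1`; its velocities cancel the negative terms to first order.
  set ε : ℂ := -(t 0 1 0 / t 0 0 1) with hε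
  set δ : ℂ := t 1 0 1 * t 0 1 1 / t 0 0 1 - t 1 1 1 with hδ
  set η : ℂ := t 1 1 1 / t 0 0 1 with hη
  refine Violates.of_curve
    (fun x => ![![-t 1 0 1 + x * δ, t 0 0 1], ![1, (x : ℂ)], ![1, ε * x]])
    (fun x => ![![x * η, 1], ![0, 1], ![1, 0]])
    ![fun x => (-t 1 0 1 + x * δ) * t 0 1 0 + ε * (x * δ * t 0 0 1)
        + ε * x * ((-t 1 0 1 + x * δ) * t 0 1 1 + t 0 0 1 * t 1 1 1),
      fun x => x * (ε * (conj η * t 1 0 1) + ε * (-t 0 1 1 + x * conj η * t 1 1 1)),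
      fun x => -(ε * (x * δ * t 0 0 1)),
      fun x => x * δ * t 0 1 1,
      fun x => ε * (x * η) * t 0 1 1,
      fun x => x * η * t 0 1 0] ?_ ?_ ?_ ?_ ?_ ?_ ?_ ?_ ?_ ?_ ?_ ?_ ?_ ?_ ?_ ?_ ?_
  · refine continuous_pi fun i => continuous_pi fun j => ?_
    fin_cases i <;> fin_cases j <;> simp <;> fun_prop
  · refine continuous_pi fun i => continuous_pi fun j => ?_
    fin_cases i <;> fin_cases j <;> simp <;> fun_prop
  · intro k
    fin_cases k <;> simp <;> fun_prop
  · intro i h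
    fin_cases i
    · exact h001 (by simpa using congrFun h 1)
    · exact one_ne_zero (α := ℂ) (by simpa using congrFun h 0)
    · exact one_ne_zero (α := ℂ) (by simpa using congrFun h 0)
  · intro i h
    fin_cases i
    · exact one_ne_zero (α := ℂ) (by simpa using congrFun h 1)
    · exact one_ne_zero (α := ℂ) (by simpa using congrFun h 1)
    · exact one_ne_zero (α := ℂ) (by simpa using congrFun h 0)
  · intro x
    simp [contract, Fin.sum_univ_two, h000, h100, h110]
    ring
  · intro x
    have : ε * t 0 0 1 = -t 0 1 0 := by rw [hε]; field_simp
    simp [contract, Fin.sum_univ_two, h000, h100, h110]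
    linear_combination (-x) * this
  · intro x
    simp [contract, Fin.sum_univ_two, h000, h100]
    ring
  · intro x
    have : δ * t 0 0 1 = t 1 0 1 * t 0 1 1 - t 1 1 1 * t 0 0 1 := by rw [hδ]; field_simp
    simp [contract, Fin.sum_univ_two]
    linear_combination x * this
  · intro x
    have : η * t 0 1 0 = -ε * t 1 1 1 := by rw [hη, hε]; field_simp
    simp [contract, Fin.sum_univ_two, h110]
    linear_combination x * this
  · intro x
    simp [contract, Fin.sum_univ_two, h000, h100, h110]
    ring
  all_goals simp [h101, h010]

/-! ### Reduction of entangled tensors to the normal form -/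

/-- The tensor `t` does not factor off any one of its three indices. -/
structure IsEntangledTensor (t : Fin 2 → Fin 2 → Fin 2 → ℂ) : Prop where
  left : ∀ u, u ≠ 0 → ∃ v w, contract t u v w ≠ 0
  mid : ∀ v, v ≠ 0 → ∃ u w, contract t u v w ≠ 0
  right : ∀ w, w ≠ 0 → ∃ u v, contract t u v w ≠ 0

/-- The components of `t` with respect to the bases `c, perp c`, `d, perp d` and `e, perp e`. -/
def rotate (t : Fin 2 → Fin 2 → Fin 2 → ℂ) (c d e : Fin 2 → ℂ) (i j k : Fin 2) : ℂ :=
  contract t (rotation c (Pi.single i 1)) (rotation d (Pi.single j 1)) (rotation e (Pi.single k 1))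

theorem contract_rotate (t : Fin 2 → Fin 2 → Fin 2 → ℂ) (c d e u v w : Fin 2 → ℂ) :
    contract (rotate t c d e) u v w = contract t (rotation c u) (rotation d v) (rotation e w) := by
  simp only [contract, rotate, rotation, Fin.sum_univ_two, Pi.add_apply, Pi.smul_apply,
    smul_eq_mul, Pi.single_eq_same, Pi.single_eq_of_ne (one_ne_zero : (1 : Fin 2) ≠ 0),
    Pi.single_eq_of_ne (zero_ne_one : (0 : Fin 2) ≠ 1), one_mul, zero_mul, add_zero, zero_add]
  ring

theorem rotation_surjective {c : Fin 2 → ℂ} (hc : c ≠ 0) (u : Fin 2 → ℂ) :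
    ∃ u', rotation c u' = u := by
  have h : c 0 * conj (c 0) + c 1 * conj (c 1) ≠ 0 := by
    rw [Complex.mul_conj, Complex.mul_conj]
    exact_mod_cast (sqNorm_pos.2 hc).ne'
  set N := c 0 * conj (c 0) + c 1 * conj (c 1) with hN
  have hinv : N⁻¹ * N = 1 := inv_mul_cancel₀ h
  refine ⟨![N⁻¹ * (u 0 * conj (c 0) + u 1 * conj (c 1)), N⁻¹ * (u 1 * c 0 - u 0 * c 1)], ?_⟩
  ext i
  fin_cases i
  · simp [rotation]
    linear_combination u 0 * hinv - u 0 * N⁻¹ * hN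
  · simp [rotation]
    linear_combination u 1 * hinv - u 1 * N⁻¹ * hN

theorem IsEntangledTensor.rotate {t : Fin 2 → Fin 2 → Fin 2 → ℂ} (ht : IsEntangledTensor t)
    {c d e : Fin 2 → ℂ} (hc : c ≠ 0) (hd : d ≠ 0) (he : e ≠ 0) :
    IsEntangledTensor (rotate t c d e) := by
  refine ⟨fun u hu => ?_, fun v hv => ?_, fun w hw => ?_⟩
  · obtain ⟨v, w, h⟩ := ht.left _ ((isSimilitude_rotation hc).map_ne_zero hu)
    obtain ⟨v, rfl⟩ := rotation_surjective hd v
    obtain ⟨w, rfl⟩ := rotation_surjective he w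
    exact ⟨v, w, by rwa [contract_rotate]⟩
  · obtain ⟨u, w, h⟩ := ht.mid _ ((isSimilitude_rotation hd).map_ne_zero hv)
    obtain ⟨u, rfl⟩ := rotation_surjective hc u
    obtain ⟨w, rfl⟩ := rotation_surjective he w
    exact ⟨u, w, by rwa [contract_rotate]⟩
  · obtain ⟨u, v, h⟩ := ht.right _ ((isSimilitude_rotation he).map_ne_zero hw)
    obtain ⟨u, rfl⟩ := rotation_surjective hc u
    obtain ⟨v, rfl⟩ := rotation_surjective hd v
    exact ⟨u, v, by rwa [contract_rotate]⟩

theorem Violates.of_rotate {t : Fin 2 → Fin 2 → Fin 2 → ℂ} {c d e : Fin 2 → ℂ} (hc : c ≠ 0)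
    (hd : d ≠ 0) (he : e ≠ 0) (h : Violates (rotate t c d e)) : Violates t :=
  h.of_similitude (L := ![rotation c, rotation d, rotation e])
    (Fin.forall_fin_succ.2 ⟨isSimilitude_rotation hc, Fin.forall_fin_two.2
      ⟨isSimilitude_rotation hd, isSimilitude_rotation he⟩⟩) (contract_rotate t c d e)

theorem exists_quadratic_form_zero (α β γ : ℂ) :
    ∃ x y : ℂ, (x ≠ 0 ∨ y ≠ 0) ∧ α * x ^ 2 + β * x * y + γ * y ^ 2 = 0 := by
  by_cases hα : α = 0
  · exact ⟨1, 0, Or.inl one_ne_zero, by simp [hα]⟩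
  · obtain ⟨s, hs⟩ := IsAlgClosed.exists_pow_nat_eq (discrim α β γ) two_pos
    obtain ⟨x, hx⟩ := exists_quadratic_eq_zero hα ⟨s, by rw [← hs, sq]⟩
    exact ⟨x, 1, Or.inr one_ne_zero, by linear_combination hx⟩

/-- Two bilinear forms on `ℂ² × ℂ²` have a common zero `(d, e)` with `d, e ≠ 0`: every
two-dimensional subspace of `ℂ² ⊗ ℂ²` contains a product vector. -/
theorem exists_common_zero (t : Fin 2 → Fin 2 → Fin 2 → ℂ) :
    ∃ d e : Fin 2 → ℂ, d ≠ 0 ∧ e ≠ 0 ∧ ∀ u, contract t u d e = 0 := by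
  obtain ⟨x, y, hxy, h⟩ := exists_quadratic_form_zero
    (t 0 0 0 * t 1 0 1 - t 0 0 1 * t 1 0 0)
    (t 0 0 0 * t 1 1 1 + t 0 1 0 * t 1 0 1 - t 0 0 1 * t 1 1 0 - t 0 1 1 * t 1 0 0)
    (t 0 1 0 * t 1 1 1 - t 0 1 1 * t 1 1 0)
  obtain ⟨e, he, hM⟩ := Matrix.exists_mulVec_eq_zero_iff.2 (show Matrix.det
    (!![x * t 0 0 0 + y * t 0 1 0, x * t 0 0 1 + y * t 0 1 1;
      x * t 1 0 0 + y * t 1 1 0, x * t 1 0 1 + y * t 1 1 1] : Matrix (Fin 2) (Fin 2) ℂ) = 0 by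
    rw [Matrix.det_fin_two_of]; linear_combination h)
  refine ⟨![x, y], e, fun h0 => ?_, he, fun u => ?_⟩
  · rcases hxy with hx | hy
    · exact hx (congrFun h0 0)
    · exact hy (congrFun h0 1)
  · have e0 := congrFun hM 0
    have e1 := congrFun hM 1
    simp [Matrix.mulVec, dotProduct, Fin.sum_univ_two] at e0 e1
    simp [contract, Fin.sum_univ_two]
    linear_combination u 0 * e0 + u 1 * e1

theorem IsEntangledTensor.violates_of_normal_form {t : Fin 2 → Fin 2 → Fin 2 → ℂ}
    (ht : IsEntangledTensor t) (h000 : t 0 0 0 = 0) (h100 : t 1 0 0 = 0) (h110 : t 1 1 0 = 0) :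
    Violates t := by
  have h010 : t 0 1 0 ≠ 0 := fun h => by
    obtain ⟨u, v, h'⟩ := ht.right (Pi.single 0 1) (by simp)
    exact h' (by simp [contract, Fin.sum_univ_two, h000, h100, h110, h])
  by_cases h001 : t 0 0 1 = 0
  · refine violates_of_orthogonal h000 h100 h110 h001 h010 fun h => ?_
    obtain ⟨u, w, h'⟩ := ht.mid (Pi.single 0 1) (by simp)
    exact h' (by simp [contract, Fin.sum_univ_two, h000, h100, h001, h])
  by_cases h101 : t 1 0 1 = 0
  · refine violates_of_parallel h000 h100 h110 h101 h010 h001 fun h => ?_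
    obtain ⟨v, w, h'⟩ := ht.left (Pi.single 1 1) (by simp)
    exact h' (by simp [contract, Fin.sum_univ_two, h100, h110, h101, h])
  · exact violates_of_generic h000 h100 h110 h010 h001 h101

theorem IsEntangledTensor.violates {t : Fin 2 → Fin 2 → Fin 2 → ℂ} (ht : IsEntangledTensor t) :
    Violates t := by
  obtain ⟨d, e, hd, he, hde⟩ := exists_common_zero t
  have r0 : ∀ c : Fin 2 → ℂ, rotation c (Pi.single 0 1) = c := fun c => by
    ext i; simp [rotation]
  have r1 : ∀ c : Fin 2 → ℂ, rotation c (Pi.single 1 1) = perp c := fun c => by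
    ext i; simp [rotation]
  -- The first basis vector of party `0` is taken along the amplitude vector `t · (perp d) e`.
  set c : Fin 2 → ℂ := fun i => conj (contract t (Pi.single i 1) (perp d) e) with hcdef
  have hexp : ∀ u v, contract t u (rotation d v) e =
      v 1 * (u 0 * conj (c 0) + u 1 * conj (c 1)) := by
    intro u v
    have := hde u
    simp only [contract, rotation, Fin.sum_univ_two, hcdef, Complex.conj_conj] at this ⊢
    simp
    linear_combination v 0 * this
  have hc : c ≠ 0 := fun h => by
    obtain ⟨u, v, h'⟩ := ht.right e he
    obtain ⟨v, rfl⟩ := rotation_surjective hd v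
    exact h' (by rw [hexp]; simp [h])
  refine Violates.of_rotate hc hd he ((ht.rotate hc hd he).violates_of_normal_form ?_ ?_ ?_)
  · rw [BellScenario.rotate, r0 d, r0 e, hde]
  · rw [BellScenario.rotate, r0 d, r0 e, hde]
  · rw [BellScenario.rotate, r0 e, hexp, r1]
    simp; ring

/-! ### From tensors to states and measurements -/

/-- A vector that is annihilated by contraction of the qubit of party `m` with a nonzero vector is
a product vector: only the direction orthogonal to that vector occurs for party `m`. -/
theorem isProductAcross_singleton {ι : Type} [Fintype ι] [DecidableEq ι] (m : ι)
    (ψ : QubitSpace ι) {c : Fin 2 → ℂ} (hc : c ≠ 0)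
    (h : ∀ s : ι → Fin 2,
      c 0 * ψ (Function.update s m 0) + c 1 * ψ (Function.update s m 1) = 0) :
    IsProductAcross {m} ψ := by
  -- If `c x ≠ 0`, the amplitudes with index `y = 1 - x` at party `m` determine all others.
  obtain ⟨f, y, hf⟩ : ∃ (f : Fin 2 → ℂ) (y : Fin 2), ∀ (s : ι → Fin 2) (x : Fin 2),
      ψ (Function.update s m x) = f x * ψ (Function.update s m y) := by
    by_cases h0 : c 0 = 0
    · have h1 : c 1 ≠ 0 := fun h1 => hc (by ext i; fin_cases i <;> assumption)
      refine ⟨![1, 0], 0, fun s x => ?_⟩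
      have := h s
      rw [h0, zero_mul, zero_add] at this
      have := (mul_eq_zero.1 this).resolve_left h1
      fin_cases x <;> simp [this]
    · refine ⟨![-(c 1 / c 0), 1], 1, fun s x => ?_⟩
      have := h s
      fin_cases x
      · simp; field_simp; linear_combination this
      · simp
  refine ⟨WithLp.toLp 2 fun r => f (r ⟨m, Finset.mem_singleton_self m⟩),
    WithLp.toLp 2 fun r => ψ fun i => if hi : i ∈ ({m} : Finset ι)ᶜ then r ⟨i, hi⟩ else y,
    fun s => ?_⟩
  have e1 : (fun i => if i ∈ ({m} : Finset ι)ᶜ then s i else y) = Function.update s m y := by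
    ext i
    by_cases hi : i = m
    · subst hi; simp
    · simp [hi]
  simp only [dite_eq_ite, e1]
  rw [← hf s (s m), Function.update_eq_self]

theorem IsGME.isEntangledTensor {ψ : QubitSpace (Fin 3)} (hψ : IsGME ψ) :
    IsEntangledTensor fun i j k => ψ ![i, j, k] := by
  have hnot : ∀ m, ¬ IsProductAcross {m} ψ := fun m =>
    hψ {m} (Finset.singleton_nonempty m) (by revert m; decide)
  refine ⟨fun u hu => ?_, fun v hv => ?_, fun w hw => ?_⟩
  · by_contra! hcon
    refine hnot 0 (isProductAcross_singleton 0 ψ hu fun s => ?_)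
    have := hcon (Pi.single (s 1) 1) (Pi.single (s 2) 1)
    have e : ∀ x, Function.update s 0 x = ![x, s 1, s 2] := fun x => by
      ext i; fin_cases i <;> rfl
    rw [e, e, ← this]
    simp [contract, Fin.sum_univ_two, Pi.single_apply]
  · by_contra! hcon
    refine hnot 1 (isProductAcross_singleton 1 ψ hv fun s => ?_)
    have := hcon (Pi.single (s 0) 1) (Pi.single (s 2) 1)
    have e : ∀ x, Function.update s 1 x = ![s 0, x, s 2] := fun x => by
      ext i; fin_cases i <;> rfl
    rw [e, e, ← this]
    simp [contract, Fin.sum_univ_two, Pi.single_apply]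
  · by_contra! hcon
    refine hnot 2 (isProductAcross_singleton 2 ψ hw fun s => ?_)
    have := hcon (Pi.single (s 0) 1) (Pi.single (s 1) 1)
    have e : ∀ x, Function.update s 2 x = ![s 0, s 1, x] := fun x => by
      ext i; fin_cases i <;> rfl
    rw [e, e, ← this]
    simp [contract, Fin.sum_univ_two, Pi.single_apply]

theorem sum_fin_three_arrow {M : Type*} [AddCommMonoid M] (f : (Fin 3 → Fin 2) → M) :
    ∑ s, f s = ∑ i, ∑ j, ∑ k, f ![i, j, k] := by
  rw [← (Fin.consEquiv fun _ : Fin 3 => Fin 2).sum_comp, Fintype.sum_prod_type]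
  refine Finset.sum_congr rfl fun i _ => ?_
  rw [← (Fin.consEquiv fun _ : Fin 2 => Fin 2).sum_comp, Fintype.sum_prod_type]
  refine Finset.sum_congr rfl fun j _ => ?_
  rw [← (Fin.consEquiv fun _ : Fin 1 => Fin 2).sum_comp, Fintype.sum_prod_type]
  refine Finset.sum_congr rfl fun k _ => ?_
  rw [Fintype.sum_unique]
  congr 1

/-- The orthonormal basis of `ℂ²` whose bras are proportional to `c` and `perp c`. -/
theorem exists_orthonormalBasis {c : Fin 2 → ℂ} (hc : c ≠ 0) :
    ∃ B : OrthonormalBasis (Fin 2) ℂ Qubit,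
      ∀ a i, starRingEnd ℂ (B a i) =
        ((√(sqNorm c))⁻¹ : ℝ) * (![c, perp c] : Fin 2 → Fin 2 → ℂ) a i := by
  set N : ℝ := (√(sqNorm c))⁻¹ with hN
  have hNN : N * N * sqNorm c = 1 := by
    have h := sqNorm_pos.2 hc
    rw [hN, ← mul_inv, Real.mul_self_sqrt h.le, inv_mul_cancel₀ h.ne']
  have hNN' : (N : ℂ) * N * (conj (c 0) * c 0 + conj (c 1) * c 1) = 1 := by
    rw [← Complex.normSq_eq_conj_mul_self, ← Complex.normSq_eq_conj_mul_self]
    exact_mod_cast hNN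
  let f : Fin 2 → Qubit := fun a =>
    WithLp.toLp 2 fun i => conj ((N : ℂ) * (![c, perp c] : Fin 2 → Fin 2 → ℂ) a i)
  have hf : Orthonormal ℂ f := by
    rw [orthonormal_iff_ite]
    intro a b
    rw [PiLp.inner_apply, Fin.sum_univ_two, RCLike.inner_apply, RCLike.inner_apply]
    fin_cases a <;> fin_cases b <;> simp [f]
    · linear_combination hNN'
    · ring
    · ring
    · linear_combination hNN'
  have hcard : Fintype.card (Fin 2) = Module.finrank ℂ Qubit := by simp
  refine ⟨(basisOfOrthonormalOfCardEqFinrank hf hcard).toOrthonormalBasis (by simpa using hf),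
    fun a i => ?_⟩
  simp [f]

/-- The Born rule for unnormalized bras. -/
theorem normSq_inner_productVector (ψ : QubitSpace (Fin 3)) (v : Fin 3 → Qubit)
    (c : Fin 3 → Fin 2 → ℂ) (n : Fin 3 → ℝ) (hn : ∀ i, 0 ≤ n i)
    (h : ∀ i x, starRingEnd ℂ (v i x) = ((√(n i))⁻¹ : ℝ) * c i x) :
    ‖inner ℂ (productVector v) ψ‖ ^ 2 =
      Complex.normSq (contract (fun i j k => ψ ![i, j, k]) (c 0) (c 1) (c 2)) /
        (n 0 * n 1 * n 2) := by
  have e : inner ℂ (productVector v) ψ =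
      (((√(n 0))⁻¹ * (√(n 1))⁻¹ * (√(n 2))⁻¹ : ℝ) : ℂ) *
        contract (fun i j k => ψ ![i, j, k]) (c 0) (c 1) (c 2) := by
    simp only [PiLp.inner_apply, productVector, RCLike.inner_apply, contract, Finset.mul_sum]
    rw [sum_fin_three_arrow]
    refine Finset.sum_congr rfl fun i _ => Finset.sum_congr rfl fun j _ =>
      Finset.sum_congr rfl fun k _ => ?_
    simp [Fin.prod_univ_three]
    rw [h 0 i, h 1 j, h 2 k]
    push_cast
    ring
  rw [e, ← Complex.normSq_eq_norm_sq, map_mul, Complex.normSq_ofReal, div_eq_inv_mul]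
  congr 1
  calc _ = ((√(n 0) * √(n 0)) * (√(n 1) * √(n 1)) * (√(n 2) * √(n 2)))⁻¹ := by
        simp only [mul_inv]; ring
    _ = _ := by rw [Real.mul_self_sqrt (hn 0), Real.mul_self_sqrt (hn 1),
        Real.mul_self_sqrt (hn 2)]

theorem Violates.exists_measurements {ψ : QubitSpace (Fin 3)}
    (h : Violates fun i j k => ψ ![i, j, k]) :
    ∃ M : Measurements (Fin 3), 0 < improvedBell (bornCorrelation ψ M) := by
  obtain ⟨a, b, ha, hb, hab⟩ := h
  choose A hA using fun i => exists_orthonormalBasis (ha i)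
  choose B hB using fun i => exists_orthonormalBasis (hb i)
  refine ⟨fun i => ![A i, B i], ?_⟩
  have key : ∀ o x : Fin 3 → Fin 2, bornCorrelation ψ (fun i => ![A i, B i]) o x =
      Complex.normSq (contract (fun i j k => ψ ![i, j, k])
        ((![![a 0, perp (a 0)], ![b 0, perp (b 0)]] : Fin 2 → Fin 2 → Fin 2 → ℂ) (x 0) (o 0))
        ((![![a 1, perp (a 1)], ![b 1, perp (b 1)]] : Fin 2 → Fin 2 → Fin 2 → ℂ) (x 1) (o 1))
        ((![![a 2, perp (a 2)], ![b 2, perp (b 2)]] : Fin 2 → Fin 2 → Fin 2 → ℂ) (x 2) (o 2))) /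
      (![sqNorm (a 0), sqNorm (b 0)] (x 0) * ![sqNorm (a 1), sqNorm (b 1)] (x 1) *
        ![sqNorm (a 2), sqNorm (b 2)] (x 2)) := by
    intro o x
    refine normSq_inner_productVector ψ _
      (fun i => (![![a i, perp (a i)], ![b i, perp (b i)]] : Fin 2 → Fin 2 → Fin 2 → ℂ)
        (x i) (o i)) (fun i => ![sqNorm (a i), sqNorm (b i)] (x i)) (fun i => ?_) fun i y => ?_
    · rcases Fin.exists_fin_two.1 ⟨x i, rfl⟩ with h | h <;> rw [h] <;> simp [sqNorm_nonneg]
    · rcases Fin.exists_fin_two.1 ⟨x i, rfl⟩ with h | h <;> rw [h]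
      · exact hA i (o i) y
      · exact hB i (o i) y
  have hval : improvedBell (bornCorrelation ψ fun i => ![A i, B i]) =
      bellValue (fun i j k => ψ ![i, j, k]) a b := by
    simp [improvedBell, key, bellValue, weight, sqNorm_perp]
  rwa [hval]

end BellScenario

/-- The Bell inequality `improvedBell p ≤ 0` holds for all bilocal correlations, and every pure
genuinely multipartite entangled three-qubit state violates it with suitable local projective
measurements; in particular these produce genuinely multipartite nonlocal correlations. -/
theorem theorem2 :
    (∀ p : Correlation (Fin 3), IsBilocal p → improvedBell p ≤ 0) ∧
    ∀ ψ : QubitSpace (Fin 3), ‖ψ‖ = 1 → IsGME ψ →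
      ∃ M : Measurements (Fin 3),
        0 < improvedBell (bornCorrelation ψ M) ∧ IsGMNL (bornCorrelation ψ M) := by
  refine ⟨fun p hp => hp.improvedBell_nonpos, fun ψ _ hψ => ?_⟩
  obtain ⟨M, hM⟩ := hψ.isEntangledTensor.violates.exists_measurements
  exact ⟨M, hM, fun h => absurd h.improvedBell_nonpos (not_le.2 hM)⟩
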